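/- **Conventions.** Alphabets are finite, and two descriptors (automata) are equivalent if they have the same input alphabet $A$ and describe the same language $L\subseteq A^*$. For $k\ge 1$, a *one-way deterministic $k$-head finite automaton* ($\mathrm{1DFA}(k)$) has a finite set of states, a read-only input tape that holds the input word between a left and a right endmarker, and $k$ heads that start on the first square after the left endmarker. Its transition function is partial: it maps the current state and the $k$ scanned symbols to a new state and, for each head, to the instruction to stay or to move one square to the right, where no head moves to the right from the right endmarker. The automaton halts when no transition is defined, and it accepts a word if it halts on it in an accepting state. Nondeterministic pushdown automata (NPDAs) are the usual ones, accepting by final state. Automata are given by finite tables, with states (and stack symbols) numbered from $0$. A *complexity measure* for such a class $E$ of automata is a total recursive function $c\colon E\to\mathbb N$ such that, for every alphabet $A$, the automata in $E$ with input alphabet $A$ are recursively enumerable in order of increasing size, and only finitely many of them have any given size. For a language $L$ over $A$ let $E(L)$ be the set of automata in $E$ with input alphabet $A$ that accept $L$. Let $c_1,c_2$ be complexity measures for $E_1,E_2$. A function $f\colon\mathbb N\to\mathbb N$ with $f(m)\ge m$ for all $m$ is an *upper bound* for the increase in complexity when changing from a minimal description in $E_1$ to an equivalent minimal description in $E_2$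 if $$\min\{c_2(D) : D\in E_2(L)\}\le f\bigl(\min\{c_1(D) : D\in E_1(L)\}\bigr)$$ for every language $L$ (over any alphabet) with $E_1(L)\neq\emptyset$ and $E_2(L)\neq\emptyset$. The *trade-off between $E_1$ and $E_2$ is non-recursive* if, for all complexity measures $c_1,c_2$ for $E_1,E_2$, no recursive function is such an upper bound. **Theorem.** Let $k\ge 2$. The trade-off between $\mathrm{1DFA}(k)$ and nondeterministic pushdown automata is non-recursive. -/

import Mathlib

/-! ## One-way deterministic multi-head finite automata -/

/-- The symbols on the tape of a multi-head automaton with input alphabet `Fin n`: the two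
endmarkers and the input letters. -/
inductive TapeSymbol (n : ℕ) where
  | left : TapeSymbol n
  | right : TapeSymbol n
  | letter (a : Fin n) : TapeSymbol n
  deriving DecidableEq

/-- Tape symbols as a two-fold option type; it only serves to code them by numbers. -/
def tapeSymbolEquiv (n : ℕ) : TapeSymbol n ≃ Option (Option (Fin n)) where
  toFun
    | .left => none
    | .right => some none
    | .letter a => some (some a)
  invFun
    | none => .left
    | some none => .right
    | some (some a) => .letter a
  left_inv x := by cases x <;> rfl
  right_inv x := by rcases x with _ | _ | _ <;> rfl

instance (n : ℕ) : Primcodable (TapeSymbol n) := Primcodable.ofEquiv _ (tapeSymbolEquiv n)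

/-- The (finite) table of a one-way `k`-head automaton with input alphabet `Fin n`. The states are
`0, …, numStates - 1`. An entry `((s, a), (t, d))` of `trans` says: in state `s`, with head `i`
scanning `a i`, the automaton may enter state `t`, and head `i` moves one square to the right if
`d i` is true and stays if `d i` is false. -/
structure HeadTable (k n : ℕ) where
  numStates : ℕ
  start : ℕ
  accept : List ℕ
  trans : List ((ℕ × (Fin k → TapeSymbol n)) × (ℕ × (Fin k → Bool)))

namespace HeadTable

variable {k n : ℕ}

/-- A table as a tuple; it only serves to code tables by numbers. -/
def equivTuple (k n : ℕ) : HeadTable k n ≃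
    ℕ × ℕ × List ℕ × List ((ℕ × (Fin k → TapeSymbol n)) × (ℕ × (Fin k → Bool))) where
  toFun M := (M.numStates, M.start, M.accept, M.trans)
  invFun t := ⟨t.1, t.2.1, t.2.2.1, t.2.2.2⟩
  left_inv _ := rfl
  right_inv _ := rfl

instance (k n : ℕ) : Primcodable (HeadTable k n) := Primcodable.ofEquiv _ (equivTuple k n)

/-- The table is that of a one-way deterministic `k`-head finite automaton. The two lists
enumerate finite sets, so they have no repetitions. -/
structure IsDFA (M : HeadTable k n) : Prop where
  start_lt : M.start < M.numStates
  accept_lt : ∀ s ∈ M.accept, s < M.numStates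
  accept_nodup : M.accept.Nodup
  trans_lt : ∀ e ∈ M.trans, e.1.1 < M.numStates ∧ e.2.1 < M.numStates
  trans_nodup : M.trans.Nodup
  /-- No head moves to the right off the right endmarker. -/
  stays_on_tape : ∀ e ∈ M.trans, ∀ i, e.1.2 i = TapeSymbol.right → e.2.2 i = false
  /-- For every state and every tuple of scanned symbols there is at most one transition. -/
  deterministic : ∀ e ∈ M.trans, ∀ e' ∈ M.trans, e.1 = e'.1 → e = e'

/-- The symbol at position `p` of the tape with inscription `w` between endmarkers: the left
endmarker is at position `0`, the letters of `w` are at `1, …, |w|`, the right endmarker is at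
`|w| + 1`. -/
def tape (w : List (Fin n)) : ℕ → TapeSymbol n
  | 0 => .left
  | p + 1 => match w[p]? with
    | some a => .letter a
    | none => .right

/-- One step on input `w`; a configuration is a state with the positions of the `k` heads. -/
def Step (M : HeadTable k n) (w : List (Fin n)) (c c' : ℕ × (Fin k → ℕ)) : Prop :=
  ∃ d : Fin k → Bool, ((c.1, fun i => tape w (c.2 i)), (c'.1, d)) ∈ M.trans ∧
    ∀ i, c'.2 i = c.2 i + if d i then 1 else 0

/-- The accepted language: the words on which some computation, started in the start state with
all heads at position `1`, halts in an accepting state. -/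
def language (M : HeadTable k n) : Language (Fin n) :=
  {w | ∃ c : ℕ × (Fin k → ℕ), Relation.ReflTransGen (M.Step w) (M.start, fun _ => 1) c ∧
    c.1 ∈ M.accept ∧ ∀ c', ¬ M.Step w c c'}

end HeadTable

/-! ## Nondeterministic pushdown automata -/

/-- The (finite) table of a nondeterministic pushdown automaton with input alphabet `Fin n`. The
states are `0, …, numStates - 1` and the stack symbols are `0, …, numStack - 1`. An entry
`((s, a, Z), (t, γ))` of `trans` says: in state `s` with `Z` on top of the stack, the automaton may
consume the letter `a` (nothing, if `a` is `none`), enter state `t` and replace `Z` by the word `γ`,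
whose first symbol comes on top. -/
structure PushdownTable (n : ℕ) where
  numStates : ℕ
  numStack : ℕ
  start : ℕ
  bottom : ℕ
  accept : List ℕ
  trans : List ((ℕ × Option (Fin n) × ℕ) × (ℕ × List ℕ))

namespace PushdownTable

variable {n : ℕ}

/-- A table as a tuple; it only serves to code tables by numbers. -/
def equivTuple (n : ℕ) : PushdownTable n ≃
    ℕ × ℕ × ℕ × ℕ × List ℕ × List ((ℕ × Option (Fin n) × ℕ) × (ℕ × List ℕ)) where
  toFun M := (M.numStates, M.numStack, M.start, M.bottom, M.accept, M.trans)
  invFun t := ⟨t.1, t.2.1, t.2.2.1, t.2.2.2.1, t.2.2.2.2.1, t.2.2.2.2.2⟩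
  left_inv _ := rfl
  right_inv _ := rfl

instance (n : ℕ) : Primcodable (PushdownTable n) := Primcodable.ofEquiv _ (equivTuple n)

/-- The table is that of a pushdown automaton. The two lists enumerate finite sets, so they have no
repetitions. -/
structure IsPDA (M : PushdownTable n) : Prop where
  start_lt : M.start < M.numStates
  bottom_lt : M.bottom < M.numStack
  accept_lt : ∀ s ∈ M.accept, s < M.numStates
  accept_nodup : M.accept.Nodup
  trans_lt : ∀ e ∈ M.trans, e.1.1 < M.numStates ∧ e.1.2.2 < M.numStack ∧
    e.2.1 < M.numStates ∧ ∀ Z ∈ e.2.2, Z < M.numStack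
  trans_nodup : M.trans.Nodup

/-- One step; a configuration consists of the state, the unread input and the stack (top first). -/
inductive Step (M : PushdownTable n) :
    ℕ × List (Fin n) × List ℕ → ℕ × List (Fin n) × List ℕ → Prop
  | intro {s t Z : ℕ} {a : Option (Fin n)} {γ : List ℕ}
      (h : ((s, a, Z), (t, γ)) ∈ M.trans) (w : List (Fin n)) (σ : List ℕ) :
      Step M (s, a.toList ++ w, Z :: σ) (t, w, γ ++ σ)

/-- The language accepted by final state. -/
def language (M : PushdownTable n) : Language (Fin n) :=
  {w | ∃ (s : ℕ) (σ : List ℕ),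
    Relation.ReflTransGen M.Step (M.start, w, [M.bottom]) (s, [], σ) ∧ s ∈ M.accept}

end PushdownTable

/-! ## Descriptors, complexity measures and trade-offs -/

/-- A kind of descriptors of formal languages. `Code n` is a type of finite objects, coded
effectively by natural numbers, `descriptors n` is the set of those that are descriptors with
alphabet `Fin n`, and `lang D` is the language over `Fin n` that `D` describes. -/
structure DescriptorKind where
  Code : ℕ → Type
  primcodable : ∀ n, Primcodable (Code n)
  descriptors : ∀ n, Set (Code n)
  lang : ∀ {n}, Code n → Language (Fin n)

namespace DescriptorKind

instance (E : DescriptorKind) (n : ℕ) : Primcodable (E.Code n) := E.primcodable n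

/-- The descriptors of the language `L`. -/
def of (E : DescriptorKind) {n : ℕ} (L : Language (Fin n)) : Set (E.Code n) :=
  {D | D ∈ E.descriptors n ∧ E.lang D = L}

/-- A complexity measure: it is recursive, and for every alphabet the descriptors are recursively
enumerable in order of increasing size, with only finitely many of each size. Values outside
`E.descriptors n` are irrelevant. -/
structure IsMeasure (E : DescriptorKind) (c : ∀ n, E.Code n → ℕ) : Prop where
  computable : ∀ n, Computable (c n)
  enumerable : ∀ n, ∃ e : ℕ → Option (E.Code n), Computable e ∧
    (∀ D, D ∈ E.descriptors n ↔ ∃ i, e i = some D) ∧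
    ∀ i j D D', i ≤ j → e i = some D → e j = some D' → c n D ≤ c n D'
  finite : ∀ n s, {D | D ∈ E.descriptors n ∧ c n D = s}.Finite

/-- The least size of a descriptor of `L`; it is used only if `L` has a descriptor. -/
noncomputable def minSize (E : DescriptorKind) (c : ∀ n, E.Code n → ℕ) {n : ℕ}
    (L : Language (Fin n)) : ℕ :=
  sInf (c n '' E.of L)

/-- `f` is an upper bound for the increase in complexity when changing from a minimal description
in `E₁` (measured by `c₁`) to an equivalent minimal description in `E₂` (measured by `c₂`). -/
def IsUpperBound (E₁ E₂ : DescriptorKind) (c₁ : ∀ n, E₁.Code n → ℕ) (c₂ : ∀ n, E₂.Code n → ℕ)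
    (f : ℕ → ℕ) : Prop :=
  (∀ m, m ≤ f m) ∧
    ∀ (n : ℕ) (L : Language (Fin n)), (E₁.of L).Nonempty → (E₂.of L).Nonempty →
      E₂.minSize c₂ L ≤ f (E₁.minSize c₁ L)

/-- The trade-off between `E₁` and `E₂` is non-recursive: whatever the complexity measures, no
recursive function is an upper bound. -/
def NonRecursiveTradeOff (E₁ E₂ : DescriptorKind) : Prop :=
  ∀ (c₁ : ∀ n, E₁.Code n → ℕ) (c₂ : ∀ n, E₂.Code n → ℕ), E₁.IsMeasure c₁ → E₂.IsMeasure c₂ →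
    ¬ ∃ f : ℕ → ℕ, Computable f ∧ IsUpperBound E₁ E₂ c₁ c₂ f

end DescriptorKind

/-- One-way deterministic `k`-head finite automata. -/
def oneWayDFA (k : ℕ) : DescriptorKind where
  Code := HeadTable k
  primcodable := inferInstance
  descriptors _ := {M | M.IsDFA}
  lang := HeadTable.language

/-- Nondeterministic pushdown automata. -/
def pushdownAutomata : DescriptorKind where
  Code := PushdownTable
  primcodable := inferInstance
  descriptors _ := {M | M.IsPDA}
  lang := PushdownTable.language

/-! The proof compares two facts about one-word languages. A pushdown automaton with a nonempty
language accepts a word whose length is computably bounded in its table. A two-head automaton can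
force its only accepted word to be as long as a computation, and no recursive function bounds that
length.

For the second fact, a partial recursive `p` is computed by a machine with a single queue, with
input `m` given in unary (`exists_queueMachine_of_partrec`). Take as word the history of the queue:
its initial contents followed by everything ever appended. Two one-way heads can check this history.
The first reads the symbols as they leave the queue. The second runs ahead and checks that the
symbols the machine then appends come next, and that the word ends exactly when the machine halts.
Hence at most one word is accepted, and it is longer than the output (`language_table`). Only a
chain of states reading the unary input depends on `m`, so the automata form a computable family
(`HeadTable.exists_computable_of_partrec`).

For the first fact, a shortest accepting run is bounded as for context-free grammars
(`exists_short_run`). A complexity measure allows listing all pushdown automata up to a given size,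
so a recursive function of the size bounds the length of a word that such an automaton accepts as
its only word (`exists_computable_wordBound`).

A recursive trade-off would therefore give every partial recursive function a recursive bound on its
domain. The running time of programs has none, by the halting problem
(`not_exists_computable_bound_partrec`). -/

/-! ## Acceptance from a configuration of a multi-head automaton -/

namespace HeadTable

variable {k n : ℕ}

/-- Some computation on `w` that starts in `c` halts in an accepting state. -/
def AcceptsFrom (M : HeadTable k n) (w : List (Fin n)) (c : ℕ × (Fin k → ℕ)) : Prop :=
  ∃ c', Relation.ReflTransGen (M.Step w) c c' ∧ c'.1 ∈ M.accept ∧ ∀ c'', ¬ M.Step w c' c''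

theorem IsDFA.step_unique {M : HeadTable k n} (hM : M.IsDFA) {w : List (Fin n)}
    {c c₁ c₂ : ℕ × (Fin k → ℕ)} (h₁ : M.Step w c c₁) (h₂ : M.Step w c c₂) : c₁ = c₂ := by
  obtain ⟨d₁, m₁, p₁⟩ := h₁
  obtain ⟨d₂, m₂, p₂⟩ := h₂
  have h := hM.deterministic _ m₁ _ m₂ rfl
  simp only [Prod.mk.injEq, true_and] at h
  obtain ⟨h, rfl⟩ := h
  exact Prod.ext h (funext fun i => by rw [p₁, p₂])

/-- By determinism the step is forced, so acceptance can be transported along it in both directions.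
-/
theorem IsDFA.acceptsFrom_iff_of_step {M : HeadTable k n} (hM : M.IsDFA) {w : List (Fin n)}
    {c c' : ℕ × (Fin k → ℕ)} (h : M.Step w c c') : M.AcceptsFrom w c ↔ M.AcceptsFrom w c' := by
  refine ⟨?_, fun ⟨x, hx, hx'⟩ => ⟨x, hx.head h, hx'⟩⟩
  rintro ⟨x, hx, hx'⟩
  rcases Relation.ReflTransGen.cases_head hx with rfl | ⟨y, hy, hyx⟩
  · exact absurd h (hx'.2 _)
  · rw [hM.step_unique h hy]
    exact ⟨x, hyx, hx'⟩

theorem acceptsFrom_iff_of_stuck {M : HeadTable k n} {w : List (Fin n)} {c : ℕ × (Fin k → ℕ)}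
    (h : ∀ c', ¬ M.Step w c c') : M.AcceptsFrom w c ↔ c.1 ∈ M.accept := by
  refine ⟨?_, fun ha => ⟨c, .refl, ha, h⟩⟩
  rintro ⟨x, hx, hx'⟩
  rcases Relation.ReflTransGen.cases_head hx with rfl | ⟨y, hy, -⟩
  · exact hx'.1
  · exact absurd hy (h _)

theorem tape_succ_eq_letter {w : List (Fin n)} {p : ℕ} {a : Fin n} :
    tape w (p + 1) = .letter a ↔ w[p]? = some a := by
  rw [tape]; split <;> simp_all

theorem tape_succ_eq_right {w : List (Fin n)} {p : ℕ} :
    tape w (p + 1) = .right ↔ w.length ≤ p := by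
  rw [tape, ← List.getElem?_eq_none_iff]; split <;> simp_all

end HeadTable

theorem List.append_singleton_prefix_iff {α : Type*} {h w : List α} {a : α} :
    h ++ [a] <+: w ↔ h <+: w ∧ w[h.length]? = some a := by
  constructor
  · rintro ⟨t, rfl⟩
    simp
  · rintro ⟨⟨t, rfl⟩, h⟩
    cases t <;> simp_all

instance (n : ℕ) : Fintype (TapeSymbol n) := Fintype.ofEquiv _ (tapeSymbolEquiv n).symm

/-! ## Queue machines -/

/-- A deterministic machine with a queue over `Fin n`. In state `q` it either halts (if `δ q` is
`none`) or removes the first symbol `a` of the queue, changes its state and appends a word. -/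
abbrev QueueMachine (Q : Type) (n : ℕ) := Q → Option (Fin n → Q × List (Fin n))

namespace QueueMachine

variable {Q : Type} {n : ℕ}

/-- One step; a configuration consists of the state, the number of symbols removed so far and the
word of all symbols that have ever been in the queue. -/
inductive Step (δ : QueueMachine Q n) : Q × ℕ × List (Fin n) → Q × ℕ × List (Fin n) → Prop
  | intro {q g t h a} (hq : δ q = some g) (ha : h[t]? = some a) :
      Step δ (q, t, h) ((g a).1, t + 1, h ++ (g a).2)

/-- The behaviour of a two-head automaton that reads the history of the queue. In the state
`(q, l)` it has to verify, with its second head, that `l` comes next on the tape; the first head is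
at the front of the queue. `none` is the accepting state. The result is the new state and which of
the two heads move. -/
def control (δ : QueueMachine Q n) : Q × List (Fin n) → TapeSymbol n → TapeSymbol n →
    Option (Option (Q × List (Fin n)) × Bool × Bool)
  | (q, y :: l), _, s => if s = .letter y then some (some (q, l), false, true) else none
  | (q, []), r, s => match δ q with
    | none => if s = .right then some (none, false, false) else none
    | some g => match r with
      | .letter a => some (some (g a), true, false)
      | _ => none

/-- Values for the first two heads, and `c` for all others. -/
def spread {α : Type} {k : ℕ} (a b c : α) (i : Fin k) : α :=
  if i.val = 0 then a else if i.val = 1 then b else c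

theorem spread_inj {α : Type} {k : ℕ} (hk : 2 ≤ k) {a b c a' b' : α}
    (h : (spread a b c : Fin k → α) = spread a' b' c) : a = a' ∧ b = b' :=
  ⟨by simpa [spread] using congrFun h ⟨0, by omega⟩,
    by simpa [spread] using congrFun h ⟨1, by omega⟩⟩

/-- The data that turn a queue machine into multi-head automata: `code` numbers the states of the
two-head automaton, `states` is a finite set of such states that contains the start state and is
closed under transitions, and `bound` is larger than all their numbers. -/
structure Coding (δ : QueueMachine Q n) where
  code : Q × List (Fin n) → ℕ
  code_injective : Function.Injective code
  states : Finset (Q × List (Fin n))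
  closed : ∀ x ∈ states, ∀ r s y d, δ.control x r s = some (some y, d) → y ∈ states
  bound : ℕ
  code_lt : ∀ x ∈ states, code x < bound
  /-- the state in which the computation starts -/
  init : Q
  /-- the first symbol of the queue -/
  first : Fin n
  /-- the second part of the initial queue -/
  rest : List (Fin n)
  init_mem : (init, first :: rest) ∈ states

namespace Coding

variable {δ : QueueMachine Q n} (C : Coding δ) (k m : ℕ)

/-- The number of a state of the two-head automaton. -/
def codeOption : Option (Q × List (Fin n)) → ℕ
  | none => C.bound
  | some x => C.code x

open Classical in
/-- The part of the table that does not depend on the initial queue. -/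
noncomputable def mainTrans : List ((ℕ × (Fin k → TapeSymbol n)) × (ℕ × (Fin k → Bool))) :=
  (C.states ×ˢ (Finset.univ : Finset (TapeSymbol n × TapeSymbol n))).toList.filterMap fun e =>
    (δ.control e.1 e.2.1 e.2.2).map fun v =>
      ((C.code e.1, spread e.2.1 e.2.2 (.letter C.first)),
        (C.codeOption v.1, spread v.2.1 v.2.2 false))

/-- The number of the state in which `j` more copies of the first symbol have to be verified. -/
def chain (j : ℕ) : ℕ :=
  Nat.casesOn j (C.code (C.init, C.first :: C.rest)) fun i => C.bound + (i + 1)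

/-- The entry that verifies one copy of the first symbol. -/
def chainEntry (j : ℕ) : (ℕ × (Fin k → TapeSymbol n)) × (ℕ × (Fin k → Bool)) :=
  ((C.bound + (j + 1), fun _ => .letter C.first), (C.chain j, spread false true false))

/-- The automaton for the queue that initially contains `m + 1` copies of the first symbol, followed
by the second part. -/
noncomputable def table : HeadTable k n where
  numStates := C.bound + (m + 1)
  start := C.chain m
  accept := [C.bound]
  trans := C.mainTrans k ++ (List.range m).map (C.chainEntry k)

variable {k m}

theorem mem_mainTrans {e} : e ∈ C.mainTrans k ↔ ∃ x ∈ C.states, ∃ r s y dr ds,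
    δ.control x r s = some (y, dr, ds) ∧
      e = ((C.code x, spread r s (.letter C.first)), (C.codeOption y, spread dr ds false)) := by
  simp only [mainTrans, List.mem_filterMap, Finset.mem_toList, Finset.mem_product,
    Finset.mem_univ, and_true, Prod.exists, Option.map_eq_some_iff]
  constructor
  · rintro ⟨q, l, r, s, hx, y, dr, ds, h, rfl⟩
    exact ⟨q, l, hx, r, s, y, dr, ds, h, rfl⟩
  · rintro ⟨q, l, hx, r, s, y, dr, ds, h, rfl⟩
    exact ⟨q, l, r, s, hx, y, dr, ds, h, rfl⟩

theorem chain_lt {j : ℕ} (hj : j ≤ m) : C.chain j < C.bound + (m + 1) := by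
  cases j with
  | zero => have := C.code_lt _ C.init_mem; change C.code _ < _; omega
  | succ i => simp only [chain]; omega

theorem codeOption_lt {x r s y d} (hx : x ∈ C.states) (h : δ.control x r s = some (y, d)) :
    C.codeOption y < C.bound + (m + 1) := by
  cases y with
  | none => simp only [codeOption]; omega
  | some y => have := C.code_lt _ (C.closed _ hx _ _ _ _ h); simp only [codeOption]; omega

theorem control_stays {x : Q × List (Fin n)} {r s y dr ds}
    (h : δ.control x r s = some (y, dr, ds)) :
    (r = .right → dr = false) ∧ (s = .right → ds = false) := by
  obtain ⟨q, _ | ⟨z, l⟩⟩ := x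
  · simp only [control] at h
    split at h
    · split_ifs at h; simp_all
    · split at h <;> simp_all
  · simp only [control] at h
    split_ifs at h with hs
    subst hs
    simp_all

/-- Main states have codes below `bound`, chain states numbers above it, and `bound` itself has no
outgoing entry. So the two parts of the table never compete, and within each part the left side of
an entry determines the entry. -/
theorem isDFA_table (hk : 2 ≤ k) : (C.table k m).IsDFA where
  start_lt := C.chain_lt le_rfl
  accept_lt s hs := by
    rw [List.mem_singleton.1 hs]; simp only [table]; omega
  accept_nodup := List.nodup_singleton _
  trans_lt e he := by
    rcases List.mem_append.1 he with h | h
    · obtain ⟨x, hx, r, s, y, dr, ds, hv, rfl⟩ := C.mem_mainTrans.1 h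
      have := C.code_lt _ hx
      exact ⟨by simp only [table]; omega, C.codeOption_lt hx hv⟩
    · obtain ⟨j, hj, rfl⟩ := List.mem_map.1 h
      rw [List.mem_range] at hj
      exact ⟨by simp only [table, chainEntry]; omega, C.chain_lt hj.le⟩
  trans_nodup := by
    refine List.Nodup.append ?_ ?_ ?_
    · refine List.Nodup.filterMap ?_ (Finset.nodup_toList _)
      rintro ⟨x, r, s⟩ ⟨x', r', s'⟩ e h h'
      simp only [Option.mem_def, Option.map_eq_some_iff] at h h'
      obtain ⟨v, -, rfl⟩ := h
      obtain ⟨v', -, h'⟩ := h'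
      simp only [Prod.mk.injEq] at h'
      obtain ⟨rfl, rfl⟩ := spread_inj hk h'.1.2
      rw [C.code_injective h'.1.1]
    · refine List.Nodup.map ?_ List.nodup_range
      intro i j h
      simp only [chainEntry, Prod.mk.injEq] at h
      omega
    · intro e h h'
      obtain ⟨x, hx, r, s, y, dr, ds, hv, rfl⟩ := C.mem_mainTrans.1 h
      obtain ⟨j, hj, h'⟩ := List.mem_map.1 h'
      have := C.code_lt _ hx
      simp only [chainEntry, Prod.mk.injEq] at h'
      omega
  stays_on_tape e he i hi := by
    rcases List.mem_append.1 he with h | h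
    · obtain ⟨x, hx, r, s, y, dr, ds, hv, rfl⟩ := C.mem_mainTrans.1 h
      have := control_stays hv
      simp only [spread] at hi ⊢
      split_ifs at hi ⊢ <;> simp_all
    · obtain ⟨j, hj, rfl⟩ := List.mem_map.1 h
      simp [chainEntry] at hi
  deterministic e he e' he' hee := by
    rcases List.mem_append.1 he with h | h <;> rcases List.mem_append.1 he' with h' | h'
    · obtain ⟨x, hx, r, s, y, dr, ds, hv, rfl⟩ := C.mem_mainTrans.1 h
      obtain ⟨x', hx', r', s', y', dr', ds', hv', rfl⟩ := C.mem_mainTrans.1 h'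
      simp only [Prod.mk.injEq] at hee
      obtain ⟨rfl, rfl⟩ := spread_inj hk hee.2
      obtain rfl := C.code_injective hee.1
      simp_all
    · obtain ⟨x, hx, r, s, y, dr, ds, hv, rfl⟩ := C.mem_mainTrans.1 h
      obtain ⟨j, hj, rfl⟩ := List.mem_map.1 h'
      have := C.code_lt _ hx
      simp only [chainEntry, Prod.mk.injEq] at hee
      omega
    · obtain ⟨x, hx, r, s, y, dr, ds, hv, rfl⟩ := C.mem_mainTrans.1 h'
      obtain ⟨j, hj, rfl⟩ := List.mem_map.1 h
      have := C.code_lt _ hx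
      simp only [chainEntry, Prod.mk.injEq] at hee
      omega
    · obtain ⟨j, hj, rfl⟩ := List.mem_map.1 h
      obtain ⟨j', hj', rfl⟩ := List.mem_map.1 h'
      simp only [chainEntry, Prod.mk.injEq] at hee
      rw [show j = j' by omega]

/-! ### Correctness of the history check. -/

section Words

variable {w : List (Fin n)}

theorem tape_spread (hw : HeadTable.tape w 1 = .letter C.first) (a b : ℕ) :
    (fun i : Fin k => HeadTable.tape w (spread a b 1 i)) =
      spread (HeadTable.tape w a) (HeadTable.tape w b) (.letter C.first) := by
  funext i
  simp only [spread]
  split_ifs <;> simp [hw]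

theorem step_iff (hk : 2 ≤ k) (hw : HeadTable.tape w 1 = .letter C.first) {x} (hx : x ∈ C.states)
    {a b : ℕ} {c} : (C.table k m).Step w (C.code x, spread a b 1) c ↔
      ∃ y dr ds, δ.control x (HeadTable.tape w a) (HeadTable.tape w b) = some (y, dr, ds) ∧
        c = (C.codeOption y, spread (a + dr.toNat) (b + ds.toNat) 1) := by
  constructor
  · rintro ⟨d, hd, hc⟩
    simp only [C.tape_spread hw] at hd
    rcases List.mem_append.1 hd with h | h
    · obtain ⟨x', hx', r, s, y, dr, ds, h, he⟩ := C.mem_mainTrans.1 h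
      simp only [Prod.mk.injEq] at he
      obtain ⟨⟨h1, h2⟩, h3, rfl⟩ := he
      obtain ⟨rfl, rfl⟩ := spread_inj hk h2
      obtain rfl := C.code_injective h1
      refine ⟨y, dr, ds, h, Prod.ext h3 (funext fun i => ?_)⟩
      rw [hc]
      simp only [spread]
      split_ifs <;> simp_all
    · obtain ⟨j, hj, he⟩ := List.mem_map.1 h
      have := C.code_lt _ hx
      simp only [chainEntry, Prod.mk.injEq] at he
      omega
  · rintro ⟨y, dr, ds, h, rfl⟩
    refine ⟨spread dr ds false, ?_, fun i => ?_⟩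
    · simp only [C.tape_spread hw]
      exact List.mem_append_left _ (C.mem_mainTrans.2 ⟨_, hx, _, _, _, _, _, h, rfl⟩)
    · simp only [spread]
      split_ifs <;> simp_all

theorem not_step_bound (c) (p) : ¬ (C.table k m).Step w (C.bound, p) c := by
  rintro ⟨d, hd, -⟩
  rcases List.mem_append.1 hd with h | h
  · obtain ⟨x, hx, r, s, y, dr, ds, h, he⟩ := C.mem_mainTrans.1 h
    have := C.code_lt _ hx
    simp only [Prod.mk.injEq] at he
    omega
  · obtain ⟨j, hj, he⟩ := List.mem_map.1 h
    simp only [chainEntry, Prod.mk.injEq] at he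
    omega

variable (k m) in
/-- `h` is a prefix of `w`, and the automaton accepts from the configuration with state `s`, first
head at `a` and second head behind `h`. -/
def Good (w : List (Fin n)) (s a : ℕ) (h : List (Fin n)) : Prop :=
  h <+: w ∧ (C.table k m).AcceptsFrom w (s, spread a (h.length + 1) 1)

theorem code_not_mem_accept {x} (hx : x ∈ C.states) : C.code x ∉ (C.table k m).accept := by
  have := C.code_lt _ hx
  simp only [table, List.mem_singleton]
  omega

/-- On a mismatch both sides fail: the automaton is stuck in a nonaccepting state, and `h ++ [y]` is
not a prefix of `w`. This is why `Good` includes the prefix condition. -/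
theorem good_cons (hk : 2 ≤ k) (hw : HeadTable.tape w 1 = .letter C.first) {q y l}
    (hx : (q, y :: l) ∈ C.states) {a h} :
    C.Good k m w (C.code (q, y :: l)) a h ↔ C.Good k m w (C.code (q, l)) a (h ++ [y]) := by
  by_cases hy : HeadTable.tape w (h.length + 1) = .letter y
  · have hs : (C.table k m).Step w (C.code (q, y :: l), spread a (h.length + 1) 1)
        (C.code (q, l), spread a ((h ++ [y]).length + 1) 1) := by
      rw [C.step_iff hk hw hx]
      exact ⟨some (q, l), false, true, by simp [control, hy], by simp [codeOption]⟩
    rw [Good, Good, (C.isDFA_table hk).acceptsFrom_iff_of_step hs,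
      List.append_singleton_prefix_iff, HeadTable.tape_succ_eq_letter.1 hy]
    simp
  · have hs : ∀ c, ¬ (C.table k m).Step w (C.code (q, y :: l), spread a (h.length + 1) 1) c := by
      intro c
      rw [C.step_iff hk hw hx]
      simp [control, hy]
    rw [Good, HeadTable.acceptsFrom_iff_of_stuck hs, Good, List.append_singleton_prefix_iff,
      ← HeadTable.tape_succ_eq_letter]
    simp [hy, C.code_not_mem_accept hx]

theorem good_append (hk : 2 ≤ k) (hw : HeadTable.tape w 1 = .letter C.first) {q a} (l)
    (hx : (q, l) ∈ C.states) (h) :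
    C.Good k m w (C.code (q, l)) a h ↔ C.Good k m w (C.code (q, [])) a (h ++ l) := by
  induction l generalizing h with
  | nil => simp
  | cons y l ih =>
    rw [C.good_cons hk hw hx, ih]
    · simp
    -- `closed` ranges over all pairs of symbols, so a symbol that triggers the transition can be
    -- chosen freely.
    · exact C.closed _ hx .right (.letter y) _ (false, true) (by simp [control])

/-- The removed symbol lies in the already verified prefix `h`, so the first head reads the same
symbol on the tape as the queue machine does. The shift by one is due to the left endmarker at
position `0`. -/
theorem good_step (hk : 2 ≤ k) (hw : HeadTable.tape w 1 = .letter C.first) {q g a t h}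
    (hx : (q, []) ∈ C.states) (hq : δ q = some g) (ha : h[t]? = some a) :
    C.Good k m w (C.code (q, [])) (t + 1) h ↔
      C.Good k m w (C.code ((g a).1, [])) (t + 2) (h ++ (g a).2) := by
  have hy : g a ∈ C.states :=
    C.closed _ hx (.letter a) .right _ (true, false) (by simp [control, hq])
  rw [← C.good_append hk hw (g a).2 hy]
  refine and_congr_right fun hp => (C.isDFA_table hk).acceptsFrom_iff_of_step ?_
  rw [C.step_iff hk hw hx]
  have ht : HeadTable.tape w (t + 1) = .letter a := by
    rw [HeadTable.tape_succ_eq_letter]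
    obtain ⟨u, rfl⟩ := hp
    rw [List.getElem?_append_left (List.getElem?_eq_some_iff.1 ha).1, ha]
  exact ⟨some (g a), true, false, by simp [control, hq, ht], by simp [codeOption]⟩

/-- The second head stands just behind the prefix `h` and sees the right endmarker exactly if
nothing of `w` is left. -/
theorem good_halt (hk : 2 ≤ k) (hw : HeadTable.tape w 1 = .letter C.first) {q a h}
    (hx : (q, []) ∈ C.states) (hq : δ q = none) :
    C.Good k m w (C.code (q, [])) a h ↔ w = h := by
  by_cases hy : HeadTable.tape w (h.length + 1) = .right
  · have hs : (C.table k m).Step w (C.code (q, []), spread a (h.length + 1) 1)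
        (C.bound, spread a (h.length + 1) 1) := by
      rw [C.step_iff hk hw hx]
      exact ⟨none, false, false, by simp [control, hy, hq], by simp [codeOption]⟩
    rw [Good, (C.isDFA_table hk).acceptsFrom_iff_of_step hs,
      HeadTable.acceptsFrom_iff_of_stuck fun c => C.not_step_bound c _]
    rw [HeadTable.tape_succ_eq_right] at hy
    simp only [table, List.mem_singleton, and_true]
    refine ⟨fun hp => (hp.eq_of_length_le hy).symm, ?_⟩
    rintro rfl
    exact List.prefix_rfl
  · have hs : ∀ c, ¬ (C.table k m).Step w (C.code (q, []), spread a (h.length + 1) 1) c := by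
      intro c
      rw [C.step_iff hk hw hx]
      simp [control, hy, hq]
    rw [Good, HeadTable.acceptsFrom_iff_of_stuck hs]
    rw [HeadTable.tape_succ_eq_right] at hy
    simp only [C.code_not_mem_accept hx, and_false, false_iff]
    rintro rfl
    exact hy le_rfl

theorem chain_step_iff (hw : HeadTable.tape w 1 = .letter C.first) {j : ℕ} (hj : j < m)
    {b : ℕ} {c} (hk : 2 ≤ k) : (C.table k m).Step w (C.chain (j + 1), spread 1 b 1) c ↔
      HeadTable.tape w b = .letter C.first ∧ c = (C.chain j, spread 1 (b + 1) 1) := by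
  constructor
  · rintro ⟨d, hd, hc⟩
    rcases List.mem_append.1 hd with h | h
    · obtain ⟨x', hx', r, s, y, dr, ds, h, he⟩ := C.mem_mainTrans.1 h
      have := C.code_lt _ hx'
      simp only [chain, Prod.mk.injEq] at he
      omega
    · obtain ⟨i, hi, he⟩ := List.mem_map.1 h
      simp only [chain, chainEntry, Prod.mk.injEq] at he
      obtain ⟨⟨h1, h2⟩, h3, rfl⟩ := he
      obtain rfl : i = j := by omega
      have := congrFun h2 ⟨1, by omega⟩
      refine ⟨by simpa [spread] using this.symm, Prod.ext h3.symm (funext fun i => ?_)⟩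
      rw [hc]
      simp only [spread]
      split_ifs <;> simp_all
  · rintro ⟨h, rfl⟩
    refine ⟨spread false true false, ?_, fun i => ?_⟩
    · refine List.mem_append_right _ (List.mem_map.2 ⟨j, List.mem_range.2 hj, ?_⟩)
      simp only [chainEntry, chain, C.tape_spread hw, h, hw]
      congr
      funext i
      simp only [spread]
      split_ifs <;> rfl
    · simp only [spread]
      split_ifs <;> simp_all

theorem good_chain (hk : 2 ≤ k) (hw : HeadTable.tape w 1 = .letter C.first) (j : ℕ) (hj : j ≤ m)
    (h) : C.Good k m w (C.chain j) 1 h ↔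
      C.Good k m w (C.code (C.init, C.first :: C.rest)) 1 (h ++ List.replicate j C.first) := by
  induction j generalizing h with
  | zero => simp [chain]
  | succ j ih =>
    have hl : h ++ List.replicate (j + 1) C.first = (h ++ [C.first]) ++ List.replicate j C.first := by
      simp [List.replicate_succ]
    rw [hl, ← ih (by omega)]
    by_cases hy : HeadTable.tape w (h.length + 1) = .letter C.first
    · have hs : (C.table k m).Step w (C.chain (j + 1), spread 1 (h.length + 1) 1)
          (C.chain j, spread 1 ((h ++ [C.first]).length + 1) 1) := by
        rw [C.chain_step_iff hw (by omega) hk]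
        simp [hy]
      rw [Good, Good, (C.isDFA_table hk).acceptsFrom_iff_of_step hs,
        List.append_singleton_prefix_iff, HeadTable.tape_succ_eq_letter.1 hy]
      simp
    · have hs : ∀ c, ¬ (C.table k m).Step w (C.chain (j + 1), spread 1 (h.length + 1) 1) c := by
        intro c
        rw [C.chain_step_iff hw (by omega) hk]
        simp [hy]
      rw [Good, HeadTable.acceptsFrom_iff_of_stuck hs, Good, List.append_singleton_prefix_iff,
        ← HeadTable.tape_succ_eq_letter]
      simp [hy, table, chain]

/-- All heads start on position `1`, and every entry leaving the start state requires the second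
head to see `first`. This also provides the symbol that the idle heads scan forever. -/
theorem tape_one_of_mem_language (hk : 2 ≤ k) (hw : w ∈ (C.table k m).language) :
    HeadTable.tape w 1 = .letter C.first := by
  by_contra h
  have hs : ∀ c, ¬ (C.table k m).Step w (C.chain m, fun _ => 1) c := by
    rintro c ⟨d, hd, -⟩
    rcases List.mem_append.1 hd with h' | h'
    · obtain ⟨x, hx, r, s, y, dr, ds, h', he⟩ := C.mem_mainTrans.1 h'
      have := C.code_lt _ hx
      simp only [Prod.mk.injEq] at he
      have h1 := congrFun he.1.2 ⟨1, by omega⟩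
      simp only [spread, one_ne_zero, if_false, if_true] at h1
      -- For `m = 0` there is no chain: the start state is a main state, and `control` itself checks
      -- the symbol.
      cases m with
      | zero =>
        obtain rfl := C.code_injective he.1.1
        simp [control, ← h1, h] at h'
      | succ j => simp only [chain] at he; omega
    · obtain ⟨i, hi, he⟩ := List.mem_map.1 h'
      simp only [chainEntry, Prod.mk.injEq] at he
      exact h (congrFun he.1.2 ⟨1, by omega⟩).symm
  have := (HeadTable.acceptsFrom_iff_of_stuck hs).1 hw
  cases m with
  | zero => exact C.code_not_mem_accept (k := k) (m := 0) C.init_mem this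
  | succ j => simp [table, chain] at this

end Words

/-- If the queue machine halts, then the automaton accepts exactly the history of the queue. -/
theorem language_table (hk : 2 ≤ k) {q t h}
    (hr : Relation.ReflTransGen δ.Step
      (C.init, 0, List.replicate m C.first ++ C.first :: C.rest) (q, t, h)) (hq : δ q = none) :
    (C.table k m).language = {h} := by
  have hfirst : List.replicate m C.first ++ [C.first] <+: h := by
    suffices H : ∀ c, Relation.ReflTransGen δ.Step
        (C.init, 0, List.replicate m C.first ++ C.first :: C.rest) c →
        List.replicate m C.first ++ [C.first] <+: c.2.2 from H _ hr
    intro c hc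
    induction hc with
    | refl => exact ⟨C.rest, by simp⟩
    | tail _ hs ih =>
      obtain ⟨hq, ha⟩ := hs
      exact ih.trans (List.prefix_append _ _)
  have hh : HeadTable.tape h 1 = .letter C.first := by
    obtain ⟨u, rfl⟩ := hfirst
    rw [HeadTable.tape_succ_eq_letter, ← List.replicate_succ', List.replicate_succ]
    simp
  ext w
  change _ ↔ w = h
  suffices H : HeadTable.tape w 1 = .letter C.first →
      (w ∈ (C.table k m).language ↔ w = h) from
    ⟨fun hw => (H (C.tape_one_of_mem_language hk hw)).1 hw, fun hw => (H (hw ▸ hh)).2 hw⟩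
  intro hw
  have h0 : w ∈ (C.table k m).language ↔ C.Good k m w (C.chain m) 1 [] := by
    simp only [Good, List.nil_prefix, true_and]
    have : (spread 1 1 1 : Fin k → ℕ) = fun _ => 1 := by
      funext i; simp only [spread]; split_ifs <;> rfl
    simp only [List.length_nil, zero_add, this]
    rfl
  rw [h0, C.good_chain hk hw m le_rfl, C.good_append hk hw _ C.init_mem, List.nil_append]
  -- Verifying a pending word symbol by symbol stays inside `states`.
  have hmem : ∀ l q, (q, l) ∈ C.states → (q, []) ∈ C.states := by
    intro l
    induction l with
    | nil => exact fun _ => id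
    | cons y l ih =>
      exact fun q hl => ih q (C.closed _ hl .right (.letter y) _ (false, true) (by simp [control]))
  obtain ⟨hm, hG⟩ : (q, []) ∈ C.states ∧ (C.Good k m w (C.code (C.init, [])) 1
      (List.replicate m C.first ++ C.first :: C.rest) ↔
        C.Good k m w (C.code (q, [])) (t + 1) h) := by
    suffices H : ∀ c, Relation.ReflTransGen δ.Step
        (C.init, 0, List.replicate m C.first ++ C.first :: C.rest) c →
        (c.1, []) ∈ C.states ∧ (C.Good k m w (C.code (C.init, [])) 1
      (List.replicate m C.first ++ C.first :: C.rest) ↔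
        C.Good k m w (C.code (c.1, [])) (c.2.1 + 1) c.2.2) from H _ hr
    intro c hc
    induction hc with
    | refl => exact ⟨hmem _ _ C.init_mem, Iff.rfl⟩
    | tail _ hs ih =>
      obtain @⟨_, g, _, _, a, hq, ha⟩ := hs
      obtain ⟨ih1, ih2⟩ := ih
      have hy : g a ∈ C.states :=
        C.closed _ ih1 (.letter a) .right _ (true, false) (by simp [control, hq])
      exact ⟨hmem _ _ hy, ih2.trans (C.good_step hk hw ih1 hq ha)⟩
  rw [hG, C.good_halt hk hw hm hq]

/-- The noncomputably chosen list `mainTrans` is a constant here; only the number of states, the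
start state and the chain entries vary with `m`. -/
theorem computable_table : Computable (C.table k) := by
  have hchain : Primrec C.chain :=
    Primrec.nat_casesOn₁ _ (Primrec.nat_add.comp (Primrec.const _) Primrec.succ)
  have hentry : Primrec (C.chainEntry k) :=
    ((Primrec.nat_add.comp (Primrec.const _) Primrec.succ).pair (Primrec.const _)).pair
      (hchain.pair (Primrec.const _))
  have htuple : Primrec fun m => (HeadTable.equivTuple k n) (C.table k m) :=
    (Primrec.nat_add.comp (Primrec.const _) Primrec.succ).pair <| hchain.pair <|
      (Primrec.const _).pair <| Primrec.list_append.comp (Primrec.const _)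
        (Primrec.list_map Primrec.list_range (hentry.comp Primrec.snd).to₂)
  exact ((Primrec.of_equiv_iff (HeadTable.equivTuple k n)).1 htuple).to_comp

end Coding

/-- A queue machine with finitely many states can be coded. -/
theorem exists_coding [Finite Q] (δ : QueueMachine Q n) (q₀ : Q) (z : Fin n) (u : List (Fin n)) :
    ∃ C : Coding δ, C.init = q₀ ∧ C.first = z ∧ C.rest = u := by
  classical
  have := Fintype.ofFinite Q
  have : Encodable Q := Fintype.toEncodable Q
  have hL : ∃ L, (z :: u).length ≤ L ∧ ∀ q g a, δ q = some g → (g a).2.length ≤ L := by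
    obtain ⟨L, hL⟩ := (Set.finite_range fun x : Q × Fin n =>
      (δ x.1).elim 0 fun g => (g x.2).2.length).bddAbove
    refine ⟨max (z :: u).length L, le_max_left _ _, fun q g a hq => le_max_of_le_right ?_⟩
    exact hL ⟨(q, a), by simp [hq]⟩
  obtain ⟨L, hu, hL⟩ := hL
  have hfin : {x : Q × List (Fin n) | x.2.length ≤ L}.Finite :=
    (Set.finite_univ.prod (List.finite_length_le (Fin n) L)).subset fun x hx => ⟨trivial, hx⟩
  obtain ⟨B, hB⟩ := (hfin.image Encodable.encode).bddAbove
  -- The states are all pairs whose pending word has length at most `L`, the maximum over the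
  -- initial word and all words that are ever appended.
  refine ⟨⟨Encodable.encode, Encodable.encode_injective, hfin.toFinset, ?_, B + 1, ?_, q₀, z, u, ?_⟩,
    rfl, rfl, rfl⟩
  · rintro ⟨q, _ | ⟨y, l⟩⟩ hx r s v d h
    · simp only [control] at h
      split at h
      · split_ifs at h; simp_all
      · rename_i g hq
        split at h
        · simp only [Option.some.injEq, Prod.mk.injEq] at h
          rw [← h.1]
          simpa using hL _ _ _ hq
        · simp at h
    · simp only [control] at h
      split_ifs at h
      simp only [Option.some.injEq, Prod.mk.injEq] at h
      simp only [Set.Finite.mem_toFinset, Set.mem_ofPred_eq, List.length_cons] at hx ⊢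
      rw [← h.1]
      simp only
      omega
  · intro x hx
    exact Nat.lt_succ_of_le (hB ⟨x, by simpa using hx, rfl⟩)
  · simpa using hu

end QueueMachine

/-! ## Pushdown automata -/

namespace PushdownTable

variable {n : ℕ}

/-- With `m` steps, each consuming anything, the automaton gets from state `p` and stack `γ` to the
empty stack and state `q`, if `r = some q`, and to an accepting state, if `r = none`. -/
inductive Run (D : PushdownTable n) : ℕ → ℕ → List ℕ → Option ℕ → Prop
  | empty (p) : Run D 0 p [] (some p)
  | accept {p} (γ) (h : p ∈ D.accept) : Run D 0 p γ none
  | step {m p a Z t β γ r} (h : ((p, a, Z), (t, β)) ∈ D.trans) (hr : Run D m t (β ++ γ) r) :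
      Run D (m + 1) p (Z :: γ) r

variable {D : PushdownTable n}

/-- Either the run first removes all of `γ₁` and only then touches `γ₂`, or it accepts without
needing `γ₂`. -/
theorem Run.split {m p γ r} (h : D.Run m p γ r) : ∀ {γ₁ γ₂}, γ = γ₁ ++ γ₂ →
    (∃ m₁ m₂ q, D.Run m₁ p γ₁ (some q) ∧ D.Run m₂ q γ₂ r ∧ m₁ + m₂ = m) ∨
      r = none ∧ D.Run m p γ₁ none := by
  induction h with
  | empty p =>
    intro γ₁ γ₂ h
    obtain ⟨rfl, rfl⟩ := List.nil_eq_append_iff.1 h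
    exact .inl ⟨0, 0, p, .empty p, .empty p, rfl⟩
  | accept γ h => exact fun _ => .inr ⟨rfl, .accept _ h⟩
  | @step m p a Z t β γ r h hr ih =>
    intro γ₁ γ₂ hγ
    cases γ₁ with
    | nil =>
      obtain rfl : Z :: γ = γ₂ := hγ
      exact .inl ⟨0, m + 1, p, .empty p, .step h hr, zero_add _⟩
    | cons Y γ₁ =>
      simp only [List.cons_append, List.cons.injEq] at hγ
      obtain ⟨rfl, rfl⟩ := hγ
      rcases ih (List.append_assoc β γ₁ γ₂).symm with ⟨m₁, m₂, q, h₁, h₂, rfl⟩ | ⟨rfl, h₁⟩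
      · exact .inl ⟨m₁ + 1, m₂, q, .step h h₁, h₂, by omega⟩
      · exact .inr ⟨rfl, .step h h₁⟩

theorem Run.join {m₁ p γ₁ r₁} (h : D.Run m₁ p γ₁ r₁) {m₂ q γ₂ r} (hq : r₁ = some q)
    (h₂ : D.Run m₂ q γ₂ r) : D.Run (m₁ + m₂) p (γ₁ ++ γ₂) r := by
  induction h with
  | empty p => cases hq; simpa using h₂
  | accept => cases hq
  | @step m p a Z t β γ r h hr ih =>
    rw [Nat.add_right_comm]
    exact .step h (by simpa using ih hq)

theorem Run.append_right {m p γ₁ r} (h : D.Run m p γ₁ r) (hr : r = none) (γ₂) :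
    D.Run m p (γ₁ ++ γ₂) none := by
  induction h with
  | empty p => cases hr
  | accept _ h => exact .accept _ h
  | @step m p a Z t β γ r h _ ih => exact .step h (by simpa using ih hr)

theorem Run.state_lt (hD : D.IsPDA) {m p γ r} (h : D.Run m p γ r) (hp : p < D.numStates) {q}
    (hr : r = some q) : q < D.numStates := by
  induction h with
  | empty p => cases hr; exact hp
  | accept _ h => cases hr
  | step h _ ih => exact ih (hD.trans_lt _ h).2.2.1 hr

theorem Run.zero_of_nil {m p r} (h : D.Run m p [] r) : m = 0 := by
  cases h <;> rfl

/-- If all runs that start with a single stack symbol and have fewer than `d` steps can be replaced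
by runs with at most `c` steps, then runs with fewer than `d` steps that start with a stack `γ` can
be replaced by runs with at most `|γ| * c` steps. -/
theorem Run.shorten (hD : D.IsPDA) {d c : ℕ}
    (H : ∀ p < D.numStates, ∀ Z < D.numStack, ∀ r, (∀ q, r = some q → q < D.numStates) →
      ∀ m < d, D.Run m p [Z] r → ∃ m' ≤ c, D.Run m' p [Z] r)
    {γ : List ℕ} : ∀ {m p r}, D.Run m p γ r → m < d → p < D.numStates →
      (∀ Z ∈ γ, Z < D.numStack) → ∃ m' ≤ γ.length * c, D.Run m' p γ r := by
  induction γ with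
  | nil =>
    intro m p r h _ _ _
    exact ⟨0, by simp, h.zero_of_nil ▸ h⟩
  | cons Z γ ih =>
    intro m p r h hm hp hZ
    have hZ0 := hZ Z (by simp)
    rcases h.split (γ₁ := [Z]) (γ₂ := γ) rfl with ⟨m₁, m₂, q, h₁, h₂, rfl⟩ | ⟨rfl, h₁⟩
    · have hq := h₁.state_lt hD hp rfl
      obtain ⟨m₁', h₁', h₁⟩ := H p hp Z hZ0 _ (by rintro _ ⟨⟩; exact hq) m₁ (by omega) h₁
      obtain ⟨m₂', h₂', h₂⟩ := ih h₂ (by omega) hq fun Y hY => hZ Y (by simp [hY])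
      refine ⟨m₁' + m₂', ?_, h₁.join rfl h₂⟩
      rw [List.length_cons, add_mul, one_mul]
      omega
    · obtain ⟨m', h', h⟩ := H p hp Z hZ0 _ (by simp) m hm h₁
      refine ⟨m', ?_, h.append_right rfl γ⟩
      rw [List.length_cons, add_mul, one_mul]
      omega

/-- An upper bound for the lengths of the words that the automaton pushes. -/
def pushBound (D : PushdownTable n) : ℕ := (D.trans.flatMap fun e => e.2.2).length

theorem length_le_pushBound {e} (h : e ∈ D.trans) : e.2.2.length ≤ D.pushBound := by
  rw [pushBound, List.length_flatMap]
  exact List.le_sum_of_mem (List.mem_map.2 ⟨e, h, rfl⟩)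

/-- An upper bound for the length of a shortest accepted word. -/
def wordBound (D : PushdownTable n) : ℕ :=
  (D.pushBound + 2) ^ (D.numStates * (D.numStack * (D.numStates + 1)))

-- Take a shortest run for each realizable triple (state, stack symbol, outcome), and rank a triple
-- by the number of triples with strictly shorter runs. After its first step a shortest run splits
-- into at most `pushBound` runs from single symbols. These are shorter, so they can be replaced by
-- shortest runs of triples of smaller rank. Hence the length grows at most by the factor `pushBound
-- + 2` per rank.
open Classical in
theorem exists_short_run (hD : D.IsPDA) {m p Z r} (h : D.Run m p [Z] r) (hp : p < D.numStates)
    (hZ : Z < D.numStack) (hr : ∀ q, r = some q → q < D.numStates) :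
    ∃ m' ≤ D.wordBound, D.Run m' p [Z] r := by
  let ex (x : ℕ × ℕ × Option ℕ) : Prop := ∃ m, D.Run m x.1 [x.2.1] x.2.2
  let least (x : ℕ × ℕ × Option ℕ) : ℕ := sInf {m | D.Run m x.1 [x.2.1] x.2.2}
  let items : Finset (ℕ × ℕ × Option ℕ) := Finset.range D.numStates ×ˢ
    (Finset.range D.numStack ×ˢ Finset.insertNone (Finset.range D.numStates))
  let before (x : ℕ × ℕ × Option ℕ) := items.filter fun y => ex y ∧ least y < least x
  have hitems : ∀ {p Z r}, (p, Z, r) ∈ items ↔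
      p < D.numStates ∧ Z < D.numStack ∧ ∀ q, r = some q → q < D.numStates := by
    intro p Z r
    cases r <;> simp [items]
  have key : ∀ d x, least x = d → ex x → x ∈ items →
      least x ≤ (D.pushBound + 2) ^ (before x).card := by
    intro d
    induction d using Nat.strong_induction_on with
    | _ d ih =>
    rintro ⟨p, Z, r⟩ hd hex hx
    obtain ⟨hp, hZ, hr⟩ := hitems.1 hx
    have hmem : D.Run d p [Z] r := hd ▸ Nat.sInf_mem (s := {m | D.Run m p [Z] r}) hex
    rw [hd]
    obtain _ | d := d
    · exact Nat.zero_le _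
    obtain _ | _ | @⟨_, _, a, _, t, β, _, _, ht, hrun⟩ := hmem
    rw [List.append_nil] at hrun
    have hlt := hD.trans_lt _ ht
    have hβ := length_le_pushBound ht
    -- In rank `0` there is no shorter realizable triple, so the bound `0` holds vacuously.
    obtain ⟨m', hm', hrun'⟩ := Run.shorten hD (d := d + 1)
      (c := if (before (p, Z, r)).card = 0 then 0 else
        (D.pushBound + 2) ^ ((before (p, Z, r)).card - 1)) (by
        intro p' hp' Z' hZ' r' hr' m hm hrun'
        have hy : (p', Z', r') ∈ items := hitems.2 ⟨hp', hZ', hr'⟩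
        have hle : least (p', Z', r') ≤ m := Nat.sInf_le hrun'
        have hyl : (p', Z', r') ∈ before (p, Z, r) :=
          Finset.mem_filter.2 ⟨hy, ⟨m, hrun'⟩, by omega⟩
        have hcard : (before (p', Z', r')).card < (before (p, Z, r)).card := by
          refine Finset.card_lt_card (Finset.ssubset_iff_of_subset ?_ |>.2 ⟨_, hyl, ?_⟩)
          · intro y hy
            simp only [before, Finset.mem_filter] at hy ⊢
            exact ⟨hy.1, hy.2.1, by omega⟩
          · simp [before]
        refine ⟨least (p', Z', r'), ?_, Nat.sInf_mem (s := {m | D.Run m p' [Z'] r'}) ⟨m, hrun'⟩⟩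
        rw [if_neg (by omega)]
        exact (ih _ (by omega) _ rfl ⟨m, hrun'⟩ hy).trans
          (Nat.pow_le_pow_right (by omega) (by omega)))
      hrun (Nat.lt_succ_self d) hlt.2.2.1 hlt.2.2.2
    have hmin : d + 1 ≤ m' + 1 :=
      hd ▸ Nat.sInf_le (s := {m | D.Run m p [Z] r}) (Run.step ht (by simpa using hrun'))
    refine hmin.trans ?_
    split_ifs at hm' with h0
    · rw [h0]; simp at hm' ⊢; omega
    · obtain ⟨c, hc⟩ := Nat.exists_eq_succ_of_ne_zero h0
      rw [hc] at hm' ⊢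
      simp only [Nat.succ_eq_add_one, Nat.add_sub_cancel] at hm'
      have h1 : 1 ≤ (D.pushBound + 2) ^ c := Nat.one_le_pow _ _ (by omega)
      rw [Nat.succ_eq_add_one, pow_succ]
      have h2 : β.length * (D.pushBound + 2) ^ c ≤ D.pushBound * (D.pushBound + 2) ^ c :=
        Nat.mul_le_mul_right _ hβ
      have h3 : (D.pushBound + 2) ^ c * (D.pushBound + 2) =
        D.pushBound * (D.pushBound + 2) ^ c + 2 * (D.pushBound + 2) ^ c := by ring
      omega
  have hx : (p, Z, r) ∈ items := hitems.2 ⟨hp, hZ, hr⟩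
  refine ⟨least (p, Z, r), (key _ _ rfl ⟨m, h⟩ hx).trans ?_,
    Nat.sInf_mem (s := {m | D.Run m p [Z] r}) ⟨m, h⟩⟩
  -- The rank is at most the number of all triples; an outcome is one of `numStates` states or
  -- acceptance.
  refine Nat.pow_le_pow_right (by omega) ((Finset.card_filter_le _ _).trans ?_)
  simp [items]

theorem exists_run_of_reaches {c : ℕ × List (Fin n) × List ℕ} {s σ}
    (h : Relation.ReflTransGen D.Step c (s, [], σ)) (hs : s ∈ D.accept) :
    ∃ m, D.Run m c.1 c.2.2 none := by
  induction h using Relation.ReflTransGen.head_induction_on with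
  | refl => exact ⟨0, .accept _ hs⟩
  | head hc _ ih =>
    obtain ⟨h, w, σ⟩ := hc
    obtain ⟨m, hm⟩ := ih
    exact ⟨m + 1, .step h hm⟩

/-- Concatenate the letters consumed along the run: each step contributes at most one, and the input
is used up exactly at acceptance. -/
theorem Run.exists_word {m p γ r} (h : D.Run m p γ r) (hr : r = none) :
    ∃ w s σ, w.length ≤ m ∧ Relation.ReflTransGen D.Step (p, w, γ) (s, [], σ) ∧ s ∈ D.accept := by
  induction h with
  | empty => cases hr
  | accept γ h => exact ⟨[], _, γ, le_rfl, .refl, h⟩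
  | @step m p a Z t β γ r h _ ih =>
    obtain ⟨w, s, σ, hw, hs, ha⟩ := ih hr
    refine ⟨a.toList ++ w, s, σ, ?_, hs.head (.intro h w γ), ha⟩
    cases a <;> simp <;> omega

/-- A nonempty language of a pushdown automaton contains a word of length at most `wordBound`. -/
theorem IsPDA.exists_short_word (hD : D.IsPDA) (h : ∃ w, w ∈ D.language) :
    ∃ w ∈ D.language, w.length ≤ D.wordBound := by
  obtain ⟨w, s, σ, h, hs⟩ := h
  obtain ⟨m, hm⟩ := exists_run_of_reaches h hs
  obtain ⟨m', hm', hrun⟩ := exists_short_run hD hm hD.start_lt hD.bottom_lt (by simp)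
  obtain ⟨w', s', σ', hw', h', hs'⟩ := hrun.exists_word rfl
  exact ⟨w', ⟨s', σ', h', hs'⟩, hw'.trans hm'⟩

/-! ### Computability of the word bound. -/

theorem primrec_equivTuple : Primrec (equivTuple n) := Primrec.of_equiv (e := equivTuple n)

theorem primrec_numStates : Primrec fun D : PushdownTable n => D.numStates := by
  have h : Primrec fun D : PushdownTable n => (equivTuple n D).1 :=
    Primrec.fst.comp primrec_equivTuple
  exact h

theorem primrec_numStack : Primrec fun D : PushdownTable n => D.numStack := by
  have h : Primrec fun D : PushdownTable n => (equivTuple n D).2.1 :=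
    Primrec.fst.comp (Primrec.snd.comp primrec_equivTuple)
  exact h

theorem primrec_trans : Primrec fun D : PushdownTable n => D.trans := by
  have h : Primrec fun D : PushdownTable n => (equivTuple n D).2.2.2.2.2 :=
    Primrec.snd.comp <| Primrec.snd.comp <| Primrec.snd.comp <| Primrec.snd.comp <|
      Primrec.snd.comp primrec_equivTuple
  exact h

theorem primrec_pushBound : Primrec (pushBound : PushdownTable n → ℕ) := by
  have hg : Primrec₂ fun (_ : PushdownTable n)
      (e : (ℕ × Option (Fin n) × ℕ) × (ℕ × List ℕ)) => e.2.2 :=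
    Primrec.snd.comp (Primrec.snd.comp Primrec.snd)
  exact Primrec.list_length.comp (Primrec.list_flatMap primrec_trans hg)

theorem _root_.Primrec.nat_pow : Primrec₂ fun a b : ℕ => a ^ b := by
  have hmul : Primrec₂ fun (a : ℕ) (p : ℕ × ℕ) => p.2 * a :=
    Primrec.nat_mul.comp (Primrec.snd.comp Primrec.snd) Primrec.fst
  refine (Primrec.nat_rec (Primrec.const 1) hmul).of_eq fun a b => ?_
  induction b with
  | zero => rfl
  | succ b ih => simp only [pow_succ, ← ih]

theorem computable_wordBound : Computable (wordBound : PushdownTable n → ℕ) := by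
  have h2 : Primrec fun D : PushdownTable n => D.pushBound + 2 :=
    Primrec.nat_add.comp primrec_pushBound (Primrec.const 2)
  have h3 : Primrec fun D : PushdownTable n => D.numStates * (D.numStack * (D.numStates + 1)) :=
    Primrec.nat_mul.comp primrec_numStates
      (Primrec.nat_mul.comp primrec_numStack (Primrec.succ.comp primrec_numStates))
  exact (Primrec.nat_pow.comp h2 h3).to_comp

/-- A pushdown automaton for the language `{w}`. -/
def singleton (w : List (Fin n)) : PushdownTable n where
  numStates := w.length + 1
  numStack := 1
  start := 0
  bottom := 0
  accept := [w.length]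
  trans := (List.finRange w.length).map fun i : Fin w.length =>
    ((i.val, some (w.get i), 0), (i.val + 1, [0]))

theorem isPDA_singleton (w : List (Fin n)) : (singleton w).IsPDA where
  start_lt := Nat.succ_pos _
  bottom_lt := Nat.one_pos
  accept_lt := by simp [singleton]
  accept_nodup := List.nodup_singleton _
  trans_lt e he := by
    obtain ⟨i, -, rfl⟩ := List.mem_map.1 he
    have := i.2
    simp only [singleton, List.mem_singleton]
    refine ⟨by omega, by omega, by omega, by omega⟩
  trans_nodup := (List.nodup_finRange _).map fun i j h => by
    simp only [Prod.mk.injEq] at h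
    exact Fin.ext h.1.1

theorem step_singleton_iff {w : List (Fin n)} {i : ℕ} {v : List (Fin n)} {σ c} :
    (singleton w).Step (i, v, σ) c ↔
      ∃ a u τ, w[i]? = some a ∧ v = a :: u ∧ σ = 0 :: τ ∧ c = (i + 1, u, σ) := by
  constructor
  · rintro ⟨h, u, τ⟩
    obtain ⟨i, -, h⟩ := List.mem_map.1 h
    simp only [Prod.mk.injEq] at h
    obtain ⟨⟨rfl, rfl, rfl⟩, rfl, rfl⟩ := h
    exact ⟨_, _, _, List.getElem?_eq_getElem i.2, rfl, rfl, rfl⟩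
  · rintro ⟨a, u, τ, ha, rfl, rfl, rfl⟩
    obtain ⟨hi, rfl⟩ := List.getElem?_eq_some_iff.1 ha
    exact .intro (a := some w[i]) (γ := [0])
      (List.mem_map.2 ⟨⟨i, hi⟩, List.mem_finRange _, rfl⟩) u τ

theorem language_singleton (w : List (Fin n)) : (singleton w).language = {w} := by
  have hcomp : ∀ v u, w = u ++ v →
      Relation.ReflTransGen (singleton w).Step (u.length, v, [0]) (w.length, [], [0]) := by
    intro v
    induction v with
    | nil => rintro u rfl; simp; rfl
    | cons a v ih =>
      intro u hw
      refine .head (step_singleton_iff.2 ⟨a, v, [], by simp [hw], rfl, rfl, rfl⟩) ?_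
      simpa using ih (u ++ [a]) (by simp [hw])
  ext v
  change _ ↔ v = w
  constructor
  · rintro ⟨s, σ, h, hs⟩
    have hs : s = w.length := List.mem_singleton.1 hs
    subst hs
    -- Going backwards from acceptance, the unread input in state `i` is what remains of `w` after
    -- `i` letters.
    suffices H : ∀ c, Relation.ReflTransGen (singleton w).Step c (w.length, [], σ) →
        c.2.1 = w.drop c.1 from H _ h
    intro c hc
    induction hc using Relation.ReflTransGen.head_induction_on with
    | refl => simp
    | @head c c' hc _ ih =>
      obtain ⟨i, v, τ⟩ := c
      obtain ⟨a, u, τ, ha, rfl, rfl, rfl⟩ := step_singleton_iff.1 hc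
      obtain ⟨hi, rfl⟩ := List.getElem?_eq_some_iff.1 ha
      simp only at ih ⊢
      rw [ih, List.drop_eq_getElem_cons hi]
  · rintro rfl
    exact ⟨_, [0], hcomp v [] rfl, List.mem_singleton.2 rfl⟩

/-- As only finitely many automata share a size, this makes their sizes unbounded. -/
theorem infinite_setOf_isPDA (n : ℕ) : {D : PushdownTable n | D.IsPDA}.Infinite := by
  refine Set.infinite_of_injective_forall_mem (f := fun i => ⟨i + 1, 1, 0, 0, [], []⟩) ?_ ?_
  · intro i j h
    simpa using h
  · intro i
    exact ⟨Nat.succ_pos _, Nat.one_pos, by simp, List.nodup_nil, by simp, List.nodup_nil⟩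

end PushdownTable

/-! ### From queue contents to queue history. -/

namespace QueueMachine

variable {Q : Type} {n : ℕ}

/-- One step, as seen from the queue. -/
inductive QueueStep (δ : QueueMachine Q n) : Q × List (Fin n) → Q × List (Fin n) → Prop
  | intro {q g a u} (hq : δ q = some g) : QueueStep δ (q, a :: u) ((g a).1, u ++ (g a).2)

/-- The current queue is the history `h` without its first `t` symbols. -/
theorem exists_step_of_queueStep {δ : QueueMachine Q n} {c c' : Q × List (Fin n)}
    (hc : Relation.ReflTransGen δ.QueueStep c c') (t h) (hu : h.drop t = c.2) :
    ∃ t' h', Relation.ReflTransGen δ.Step (c.1, t, h) (c'.1, t', h') ∧ h'.drop t' = c'.2 := by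
  induction hc with
  | refl => exact ⟨t, h, .refl, hu⟩
  | tail _ hs ih =>
    obtain @⟨q, g, a, u, hq⟩ := hs
    obtain ⟨t', h', hr, hd⟩ := ih
    have hlt : t' < h'.length := by
      by_contra hlt
      simp [List.drop_eq_nil_of_le (not_lt.1 hlt)] at hd
    rw [List.drop_eq_getElem_cons hlt] at hd
    simp only [List.cons.injEq] at hd
    refine ⟨_, _, hr.tail (.intro hq (a := a) (by rw [List.getElem?_eq_getElem hlt, hd.1])), ?_⟩
    rw [List.drop_append_of_le_length (by omega), hd.2]

end QueueMachine

/-! ## Stack machines that work on one stack at a time -/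

namespace Turing.PartrecToTM2

/-- A state of the machine that executes the statements of `tr` one by one. -/
abbrev MicroState := Option (TM2.Stmt (fun _ : K' => Γ') Λ' (Option Γ')) × Option Γ'

/-- The action in a given state: it reads, and removes, the top of one stack (`none` if the stack is
empty), pushes a word on it, and changes the state. -/
def micro : MicroState → Option (K' × (Option Γ' → MicroState × List Γ'))
  | (none, _) => none
  | (some (.push k f q), v) => some (k, fun o => ((some q, v), f v :: o.toList))
  | (some (.peek k f q), v) => some (k, fun o => ((some q, f v o), o.toList))
  | (some (.pop k f q), v) => some (k, fun o => ((some q, f v o), []))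
  | (some (.load f q), v) => some (.main, fun o => ((some q, f v), o.toList))
  | (some (.branch f q₁ q₂), v) =>
    some (.main, fun o => ((some (cond (f v) q₁ q₂), v), o.toList))
  | (some (.goto l), v) => some (.main, fun o => ((some (tr (l v)), v), o.toList))
  | (some .halt, v) => some (.main, fun o => ((none, v), o.toList))

/-- One step of this machine. -/
inductive MicroStep : MicroState × (K' → List Γ') → MicroState × (K' → List Γ') → Prop
  | intro {x k g} (S : K' → List Γ') (hx : micro x = some (k, g)) :
      MicroStep (x, S) ((g (S k).head?).1,
        Function.update S k ((g (S k).head?).2 ++ (S k).tail))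

theorem MicroStep.of_eq {x k g} {S : K' → List Γ'} {c} (hx : micro x = some (k, g))
    (h₁ : (g (S k).head?).1 = c.1)
    (h₂ : Function.update S k ((g (S k).head?).2 ++ (S k).tail) = c.2) : MicroStep (x, S) c := by
  obtain ⟨c₁, c₂⟩ := c
  simp only at h₁ h₂
  subst h₁ h₂
  exact .intro S hx

theorem head?_toList_append_tail {α : Type*} (l : List α) : l.head?.toList ++ l.tail = l := by
  cases l <;> rfl

theorem microStep_stepAux (q : TM2.Stmt (fun _ : K' => Γ') Λ' (Option Γ')) (v S) :
    Relation.ReflTransGen MicroStep ((some q, v), S)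
      (((TM2.stepAux q v S).l.map tr, (TM2.stepAux q v S).var), (TM2.stepAux q v S).stk) := by
  induction q generalizing v S with
  | push k f q ih =>
    exact .head (.of_eq rfl rfl (by simp [head?_toList_append_tail])) (ih _ _)
  | peek k f q ih =>
    exact .head (.of_eq rfl rfl (by simp [head?_toList_append_tail])) (ih _ S)
  | pop k f q ih =>
    exact .head (.of_eq rfl rfl (by simp)) (ih _ _)
  | load f q ih =>
    exact .head (.of_eq rfl rfl (by simp [head?_toList_append_tail])) (ih _ S)
  | branch f q₁ q₂ ih₁ ih₂ =>
    refine .head (b := ((some (cond (f v) q₁ q₂), v), S))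
      (.of_eq rfl rfl (by simp [head?_toList_append_tail])) ?_
    simp only [TM2.stepAux]
    cases f v
    · exact ih₂ _ _
    · exact ih₁ _ _
  | goto l =>
    exact .single (.of_eq rfl rfl (by simp [head?_toList_append_tail]))
  | halt =>
    exact .single (.of_eq rfl rfl (by simp [head?_toList_append_tail]))

theorem microStep_reaches {c c'} (h : StateTransition.Reaches (TM2.step tr) c c') :
    Relation.ReflTransGen MicroStep ((c.l.map tr, c.var), c.stk)
      ((c'.l.map tr, c'.var), c'.stk) := by
  induction h with
  | refl => exact .refl
  | @tail c c' _ hs ih =>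
    refine ih.trans ?_
    obtain ⟨_ | l, v, S⟩ := c
    · cases hs
    · simp only [TM2.step, Option.mem_def, Option.some.injEq] at hs
      subst hs
      exact microStep_stepAux _ _ _

/-- A finite set of states that is closed under the actions. -/
noncomputable def microStates (c : ToPartrec.Code) : Finset MicroState :=
  TM2.stmts tr (codeSupp c Cont'.halt) ×ˢ Finset.univ

theorem mem_microStates {c : ToPartrec.Code} {x : MicroState} :
    x ∈ microStates c ↔ x.1 ∈ TM2.stmts tr (codeSupp c Cont'.halt) := by
  simp [microStates]

theorem some_mem_stmts {S : Finset Λ'} {l : Λ'} (hl : l ∈ S) : some (tr l) ∈ TM2.stmts tr S := by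
  classical
  exact Finset.some_mem_insertNone.2 (Finset.mem_biUnion.2 ⟨l, hl, TM2.stmts₁_self⟩)

/-- A `goto` leads to a label in the support of the program; all other statements continue with a
substatement or halt. -/
theorem mem_microStates_of_micro {c : ToPartrec.Code} {x : MicroState} (hx : x ∈ microStates c)
    {k g} (h : micro x = some (k, g)) (o : Option Γ') : (g o).1 ∈ microStates c := by
  classical
  obtain ⟨_ | q, v⟩ := x
  · simp [micro] at h
  rw [mem_microStates] at hx ⊢
  cases q with
  | goto l =>
    cases h
    -- `TM2.Supports` takes the start label to be the default label.
    let _ : Inhabited Λ' := ⟨trNormal c Cont'.halt⟩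
    exact some_mem_stmts (TM2.stmts_supportsStmt (tr_supports c Cont'.halt) hx v)
  | halt => cases h; simp [TM2.stmts]
  | branch f q₁ q₂ =>
    cases h
    refine TM2.stmts_trans ?_ hx
    cases f v <;> simp [TM2.stmts₁, TM2.stmts₁_self]
  | _ =>
    cases h
    refine TM2.stmts_trans ?_ hx
    simp [TM2.stmts₁, TM2.stmts₁_self]

/-! ## Four stacks in a queue -/

/-- The code of a stack symbol in the queue; `4` is the separator. -/
def symbol : Γ' → Fin 5
  | .consₗ => 0
  | .cons => 1
  | .bit0 => 2
  | .bit1 => 3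

/-- The stack symbol with a given code. -/
def ofSymbol (a : Fin 5) : Γ' := if a = 0 then .consₗ else if a = 1 then .cons else
  if a = 2 then .bit0 else .bit1

@[simp]
theorem ofSymbol_symbol (x : Γ') : ofSymbol (symbol x) = x := by cases x <;> rfl

@[simp]
theorem symbol_ne (x : Γ') : symbol x ≠ 4 := by cases x <;> decide

/-- The cyclic order of the stacks. -/
def next : K' → K'
  | .main => .rev
  | .rev => .aux
  | .aux => .stack
  | .stack => .main

/-- The part of the queue for a single stack. -/
def segment (l : List Γ') : List (Fin 5) := l.map symbol ++ [4]

/-- The queue for four stacks, the first of which is `k`. -/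
def queue (S : K' → List Γ') (k : K') : List (Fin 5) :=
  segment (S k) ++ (segment (S (next k)) ++ (segment (S (next (next k))) ++
    segment (S (next (next (next k))))))

/-- The queue machine. In a state `(x, k, b)` the front of the queue is in the segment of the
stack `k`, at its beginning if `b` is false. -/
noncomputable def queueMachine {T : Finset MicroState} (clip : MicroState → T) :
    QueueMachine (T × K' × Bool) 5
  | (x, k, true) => some fun a =>
    if a = 4 then ((x, next k, false), [4]) else ((x, k, true), [a])
  | (x, k, false) => (micro x).map fun e a =>
    if e.1 = k then
      if a = 4 then ((clip (e.2 none).1, next k, false), segment (e.2 none).2)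
      else ((clip (e.2 (some (ofSymbol a))).1, k, true),
        (e.2 (some (ofSymbol a))).2.map symbol)
    else if a = 4 then ((x, next k, false), [4]) else ((x, k, true), [a])

section

variable {T : Finset MicroState} {clip : MicroState → T}

theorem queueStep_of_eq {q : T × K' × Bool} {g a u c} (hq : queueMachine clip q = some g)
    (h₁ : (g a).1 = c.1) (h₂ : u ++ (g a).2 = c.2) :
    (queueMachine clip).QueueStep (q, a :: u) c := by
  obtain ⟨c₁, c₂⟩ := c
  simp only at h₁ h₂
  subst h₁ h₂
  exact .intro hq

theorem queue_copy (x : T) (k : K') (l : List Γ') (u) :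
    Relation.ReflTransGen (queueMachine clip).QueueStep ((x, k, true), segment l ++ u)
      ((x, next k, false), u ++ segment l) := by
  induction l generalizing u with
  | nil => exact .single (queueStep_of_eq rfl rfl rfl)
  | cons a l ih =>
    refine .head (b := ((x, k, true), (segment l ++ u) ++ [symbol a]))
      (queueStep_of_eq rfl ?_ ?_) ?_
    · simp
    · simp [segment]
    · have := ih (u ++ [symbol a])
      simpa [segment] using this

theorem queue_skip {x : T} {k k' : K'} {g} (hx : micro x = some (k', g)) (hk : k' ≠ k)
    (l : List Γ') (u) :
    Relation.ReflTransGen (queueMachine clip).QueueStep ((x, k, false), segment l ++ u)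
      ((x, next k, false), u ++ segment l) := by
  have hq : queueMachine clip (x, k, false) = some fun a =>
      if a = 4 then ((x, next k, false), [4]) else ((x, k, true), [a]) := by
    simp [queueMachine, hx, hk]
  cases l with
  | nil => exact .single (queueStep_of_eq hq (by simp) (by simp [segment]))
  | cons a l =>
    refine .head (b := ((x, k, true), (segment l ++ u) ++ [symbol a]))
      (queueStep_of_eq hq ?_ ?_) ?_
    · simp
    · simp [segment]
    · have := queue_copy (clip := clip) x k l (u ++ [symbol a])
      simpa [segment] using this

theorem queue_act {x : T} {k : K'} {g} (hx : micro x = some (k, g)) (l : List Γ') (u) :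
    Relation.ReflTransGen (queueMachine clip).QueueStep ((x, k, false), segment l ++ u)
      ((clip (g l.head?).1, next k, false), u ++ segment ((g l.head?).2 ++ l.tail)) := by
  have hq : queueMachine clip (x, k, false) = some fun a =>
      if a = 4 then ((clip (g none).1, next k, false), segment (g none).2)
      else ((clip (g (some (ofSymbol a))).1, k, true),
        (g (some (ofSymbol a))).2.map symbol) := by
    simp [queueMachine, hx]
  cases l with
  | nil => exact .single (queueStep_of_eq hq (by simp) (by simp))
  | cons a l =>
    refine .head (b := ((clip (g (some a)).1, k, true),
      (segment l ++ u) ++ (g (some a)).2.map symbol)) (queueStep_of_eq hq ?_ ?_) ?_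
    · simp
    · simp [segment]
    · have := queue_copy (clip := clip) (clip (g (some a)).1) k l (u ++ (g (some a)).2.map symbol)
      simpa [segment] using this

/-- Segments are rotated to the back until that of stack `k` is in front, where the action is
carried out. The queue is not rotated back, so each simulated step may begin and end with any stack
in front. -/
theorem queue_step {x : T} {k : K'} {g} (hx : micro x = some (k, g)) (S : K' → List Γ') :
    ∀ j : K', ∃ j', Relation.ReflTransGen (queueMachine clip).QueueStep ((x, j, false), queue S j)
      ((clip (g (S k).head?).1, j', false),
        queue (Function.update S k ((g (S k).head?).2 ++ (S k).tail)) j') := by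
  have hact : ∃ j', Relation.ReflTransGen (queueMachine clip).QueueStep
      ((x, k, false), queue S k) ((clip (g (S k).head?).1, j', false),
        queue (Function.update S k ((g (S k).head?).2 ++ (S k).tail)) j') := by
    refine ⟨next k, ?_⟩
    have := queue_act (clip := clip) hx (S k) (segment (S (next k)) ++ (segment (S (next (next k)))
      ++ segment (S (next (next (next k))))))
    convert this using 2
    all_goals cases k <;> simp [queue, next]
  have hskip : ∀ j, k ≠ j →
      Relation.ReflTransGen (queueMachine clip).QueueStep
        ((x, j, false), queue S j) ((x, next j, false), queue S (next j)) := by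
    intro j hj
    have := queue_skip (clip := clip) hx hj (S j) (segment (S (next j)) ++
      (segment (S (next (next j))) ++ segment (S (next (next (next j))))))
    convert this using 2
    all_goals cases j <;> simp [queue, next]
  have hiter : ∀ i j, next^[i] j = k → ∃ j', Relation.ReflTransGen (queueMachine clip).QueueStep
      ((x, j, false), queue S j) ((clip (g (S k).head?).1, j', false),
        queue (Function.update S k ((g (S k).head?).2 ++ (S k).tail)) j') := by
    intro i
    induction i with
    | zero => rintro j rfl; exact hact
    | succ i ih =>
      intro j hj
      by_cases hjk : k = j
      · exact hjk ▸ hact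
      · obtain ⟨j', h⟩ := ih (next j) hj
        exact ⟨j', (hskip j hjk).trans h⟩
  intro j
  have : ∃ i, next^[i] j = k := by
    cases j <;> cases k <;>
      first | exact ⟨0, rfl⟩ | exact ⟨1, rfl⟩ | exact ⟨2, rfl⟩ | exact ⟨3, rfl⟩
  exact this.elim fun i hi => hiter i j hi

end

/-- `clip` only serves to make the state set finite; on the states that occur it changes nothing. -/
theorem exists_queue_of_reaches {c : ToPartrec.Code} {clip : MicroState → microStates c}
    (hclip : ∀ x ∈ microStates c, (clip x : MicroState) = x) {y y'}
    (h : Relation.ReflTransGen MicroStep y y') (hy : y.1 ∈ microStates c) (j : K') :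
    y'.1 ∈ microStates c ∧ ∃ j', Relation.ReflTransGen (queueMachine clip).QueueStep
      ((clip y.1, j, false), queue y.2 j) ((clip y'.1, j', false), queue y'.2 j') := by
  induction h with
  | refl => exact ⟨hy, j, .refl⟩
  | tail _ hs ih =>
    obtain @⟨x, k, g, S, hx⟩ := hs
    obtain ⟨hm, j', hr⟩ := ih
    obtain ⟨j'', hr'⟩ := queue_step (clip := clip) (x := clip x) (by rw [hclip _ hm]; exact hx) S j'
    exact ⟨mem_microStates_of_micro hm hx _, j'', hr.trans hr'⟩

/-- Every code is simulated by a queue machine with finitely many states. -/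
theorem exists_queueMachine (c : ToPartrec.Code) : ∃ (Q : Type) (_ : Finite Q)
    (δ : QueueMachine Q 5) (q₀ : Q), ∀ v r, r ∈ c.eval v →
      ∃ q t h, Relation.ReflTransGen δ.Step
        (q₀, 0, (trList v).map symbol ++ [4, 4, 4, 4]) (q, t, h) ∧ δ q = none ∧
          (trList r).length ≤ h.length := by
  classical
  let x₀ : MicroState := (some (tr (trNormal c Cont'.halt)), none)
  have hx₀ : x₀ ∈ microStates c := by
    rw [mem_microStates]
    exact some_mem_stmts (tr_supports c Cont'.halt).1
  let clip : MicroState → microStates c := fun x =>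
    if h : x ∈ microStates c then ⟨x, h⟩ else ⟨x₀, hx₀⟩
  have hclip : ∀ x ∈ microStates c, (clip x : MicroState) = x := fun x hx => by simp [clip, hx]
  have : Finite K' := Finite.of_surjective
    (fun i : Fin 4 => if i = 0 then K'.main else if i = 1 then .rev else if i = 2 then .aux else
      .stack) fun k => by
      cases k
      exacts [⟨0, rfl⟩, ⟨1, rfl⟩, ⟨2, rfl⟩, ⟨3, rfl⟩]
  refine ⟨microStates c × K' × Bool, inferInstance, queueMachine clip, (clip x₀, .main, false), ?_⟩
  intro v r hr
  have heval : halt r ∈ StateTransition.eval (TM2.step tr) (init c v) := by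
    rw [tr_eval]
    exact Part.mem_map _ hr
  obtain ⟨hm, j, hq⟩ := exists_queue_of_reaches hclip
    (microStep_reaches (StateTransition.mem_eval.1 heval).1) hx₀ .main
  obtain ⟨t, h, hs, hd⟩ := QueueMachine.exists_step_of_queueStep hq 0
    (queue (init c v).stk .main) rfl
  have hqueue : queue (init c v).stk .main = (trList v).map symbol ++ [4, 4, 4, 4] := by
    simp [queue, init, segment, next]
  refine ⟨(clip ((halt r).l.map tr, (halt r).var), j, false), t, h, ?_, ?_, ?_⟩
  · rw [← hqueue]
    exact hs
  · simp only [queueMachine]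
    rw [hclip _ hm]
    rfl
  -- The final queue, which contains the output, is a suffix of the history.
  · have hle : (queue (halt r).stk j).length ≤ h.length := by
      have := congrArg List.length hd
      rw [List.length_drop] at this
      exact this.symm.trans_le (Nat.sub_le _ _)
    refine le_trans ?_ hle
    cases j <;> simp [queue, halt, segment, next] <;> omega

/-! ### Powers of two as unary notation: low digits come first, so `2 ^ m` is a block of `m` zeros
and a one. -/

theorem exists_trNat_two_pow (m : ℕ) : ∃ p : PosNum, ((2 ^ m : ℕ) : Num) = .pos p ∧
    trPosNum p = List.replicate m .bit0 ++ [.bit1] := by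
  induction m with
  | zero => exact ⟨1, by simp; rfl, rfl⟩
  | succ m ih =>
    obtain ⟨p, hp, ht⟩ := ih
    refine ⟨p.bit0, ?_, ?_⟩
    · have h : ((2 ^ (m + 1) : ℕ) : Num) = ((2 ^ m : ℕ) : Num).bit0 := by
        rw [pow_succ, mul_two, Nat.cast_add, Num.bit0_of_bit0]
      rw [h, hp]
      rfl
    · rw [trPosNum, ht, List.replicate_succ, List.cons_append]

theorem trList_two_pow (m : ℕ) :
    trList [2 ^ m] = List.replicate m .bit0 ++ [.bit1, .cons] := by
  obtain ⟨p, hp, ht⟩ := exists_trNat_two_pow m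
  simp [trNat, hp, trNum, ht]

/-- A partial recursive function can be computed by a queue machine with finitely many states in
such a way that the function values are at most as large as the number of symbols ever in the
queue. -/
theorem exists_queueMachine_of_partrec {p : ℕ →. ℕ} (hp : Partrec p) :
    ∃ (Q : Type) (_ : Finite Q) (δ : QueueMachine Q 5) (q₀ : Q) (z : Fin 5) (u : List (Fin 5)),
      ∀ m, ∀ v ∈ p m, ∃ q t h, Relation.ReflTransGen δ.Step
        (q₀, 0, List.replicate m z ++ z :: u) (q, t, h) ∧ δ q = none ∧ v ≤ h.length := by
  -- `f` sends `2 ^ (j + 1)` to `2 ^ p j`. The input is then unary, with the `j + 1` copies of one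
  -- symbol that the automaton expects, and the output takes up more than `p j` cells.
  let f : ℕ →. ℕ := fun n =>
    (Nat.rfind fun j => Part.some (decide (n = 2 ^ (j + 1)))).bind fun j => (p j).map (2 ^ ·)
  have hf : Partrec f := by
    have hpow : Computable fun j : ℕ => 2 ^ j :=
      (Primrec.nat_pow.comp (Primrec.const 2) Primrec.id).to_comp
    have hpow₂ : Computable₂ fun (_ : ℕ × ℕ) (v : ℕ) => 2 ^ v := hpow.comp Computable.snd
    have hdec : Computable₂ fun n j : ℕ => decide (n = 2 ^ (j + 1)) :=
      (Primrec.eq (α := ℕ)).decide.to_comp.comp Computable.fst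
        (hpow.comp (Computable.succ.comp Computable.snd))
    refine Partrec.bind (Partrec.rfind hdec.partrec₂) ?_
    exact Partrec.map (hp.comp Computable.snd) hpow₂
  have hf2 : ∀ m v, v ∈ p m → 2 ^ v ∈ f (2 ^ (m + 1)) := by
    intro m v hv
    refine Part.mem_bind_iff.2 ⟨m, ?_, Part.mem_map _ hv⟩
    refine Nat.mem_rfind.2 ⟨by simp, fun {j} hj => ?_⟩
    have : (2 : ℕ) ^ (m + 1) ≠ 2 ^ (j + 1) := fun h => by
      have := Nat.pow_right_injective le_rfl h
      omega
    simpa using this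
  obtain ⟨c, hc⟩ := ToPartrec.Code.exists_code (Nat.Partrec'.part_iff₁.2 hf)
  obtain ⟨Q, hQ, δ, q₀, hδ⟩ := exists_queueMachine c
  refine ⟨Q, hQ, δ, q₀, symbol .bit0, [symbol .bit1, symbol .cons, 4, 4, 4, 4], fun m v hv => ?_⟩
  have hmem : [2 ^ v] ∈ c.eval [2 ^ (m + 1)] := by
    have := hc ⟨[2 ^ (m + 1)], rfl⟩
    simp only [List.Vector.head] at this
    rw [this]
    exact Part.mem_map _ (hf2 m v hv)
  obtain ⟨q, t, h, hr, hq, hl⟩ := hδ _ _ hmem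
  refine ⟨q, t, h, ?_, hq, ?_⟩
  · convert hr using 3
    rw [trList_two_pow, List.replicate_succ']
    simp
  · rw [trList_two_pow] at hl
    simp at hl
    omega

end Turing.PartrecToTM2

/-- A partial recursive function `p` gives rise to a computable family of automata, the `m`-th of
which accepts a single word, of length at least `p m`, whenever `p m` is defined. -/
theorem HeadTable.exists_computable_of_partrec {p : ℕ →. ℕ} (hp : Partrec p) {k : ℕ}
    (hk : 2 ≤ k) : ∃ M : ℕ → HeadTable k 5, Computable M ∧ (∀ m, (M m).IsDFA) ∧
      ∀ m, ∀ v ∈ p m, ∃ w, (M m).language = {w} ∧ v ≤ w.length := by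
  obtain ⟨Q, hQ, δ, q₀, z, u, hδ⟩ := Turing.PartrecToTM2.exists_queueMachine_of_partrec hp
  obtain ⟨C, rfl, rfl, rfl⟩ := δ.exists_coding q₀ z u
  refine ⟨C.table k, C.computable_table, fun m => C.isDFA_table hk, fun m v hv => ?_⟩
  obtain ⟨q, t, h, hr, hq, hl⟩ := hδ m v hv
  exact ⟨h, C.language_table hk hr hq, hl⟩

/-! ## The trade-off -/

theorem Partrec.computable_get {α σ : Type*} [Primcodable α] [Primcodable σ] {f : α →. σ}
    (hf : Partrec f) (h : ∀ a, (f a).Dom) : Computable fun a => (f a).get (h a) :=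
  hf.of_eq fun a => (Part.some_get (h a)).symm

theorem Computable.sum_range {f : ℕ → ℕ} (hf : Computable f) :
    Computable fun s => ∑ i ∈ Finset.range s, f i := by
  have h : Computable₂ fun (_ : ℕ) (p : ℕ × ℕ) => p.2 + f p.1 :=
    Primrec.nat_add.to_comp.comp (Computable.snd.comp Computable.snd)
      (hf.comp (Computable.fst.comp Computable.snd))
  refine (Computable.nat_rec Computable.id (Computable.const 0) h).of_eq fun s => ?_
  induction s with
  | zero => rfl
  | succ s ih =>
    rw [Finset.sum_range_succ, ← ih]
    rfl

/-- There is a computable bound for the lengths of the words in the one-word languages that are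
described by pushdown automata of a given size. -/
theorem exists_computable_wordBound {c : ∀ n, PushdownTable n → ℕ}
    (hc : pushdownAutomata.IsMeasure c) (n : ℕ) : ∃ B : ℕ → ℕ, Computable B ∧
      ∀ s (w : List (Fin n)) (D : PushdownTable n), D.IsPDA → D.language = {w} → c n D ≤ s →
        w.length ≤ B s := by
  obtain ⟨e, he, hmem, hmono⟩ := hc.enumerable n
  change ℕ → Option (PushdownTable n) at e
  change Computable e at he
  have hcn : Computable (c n) := hc.computable n
  -- Some listed automaton is larger than `s`, so the search for one terminates.
  have hex : ∀ s, ∃ i D, e i = some D ∧ s < c n D := by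
    intro s
    by_contra! hcon
    refine PushdownTable.infinite_setOf_isPDA n (Set.Finite.subset
      ((Set.finite_Iic s).biUnion fun i _ => hc.finite n i) fun D hD => ?_)
    obtain ⟨i, hi⟩ := (hmem D).1 hD
    exact Set.mem_biUnion (hcon i D hi) ⟨hD, rfl⟩
  let large : ℕ → ℕ → Bool := fun s i => ((e i).map fun D => decide (s < c n D)).getD false
  have hlarge : Computable₂ large := by
    have h : Computable₂ fun (x : ℕ × ℕ) (D : PushdownTable n) => decide (x.1 < c n D) :=
      Primrec.nat_lt.decide.to_comp.comp (Computable.fst.comp Computable.fst)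
        (hcn.comp Computable.snd)
    exact Computable.option_getD (Computable.option_map (he.comp Computable.snd) h)
      (Computable.const false)
  have hdom : ∀ s, (Nat.rfind fun i => Part.some (large s i)).Dom := by
    intro s
    obtain ⟨i, D, hi, hD⟩ := hex s
    exact Nat.rfind_dom.2 ⟨i, by simp [large, hi, hD], fun _ => trivial⟩
  -- Sizes do not decrease along the enumeration, so every automaton of size at most `s` is listed
  -- before index `N s`.
  let N : ℕ → ℕ := fun s => (Nat.rfind fun i => Part.some (large s i)).get (hdom s)
  have hN : Computable N := (Partrec.rfind hlarge.partrec₂).computable_get hdom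
  have hNspec : ∀ s, ∃ D, e (N s) = some D ∧ s < c n D := by
    intro s
    have h : true ∈ Part.some (large s (N s)) := Nat.rfind_spec (Part.get_mem (hdom s))
    replace h : large s (N s) = true := (Part.mem_some_iff.1 h).symm
    simp only [large] at h
    cases hD : e (N s) with
    | none => simp [hD] at h
    | some D => exact ⟨D, rfl, by simpa [hD] using h⟩
  let g : ℕ → ℕ := fun i => ((e i).map PushdownTable.wordBound).getD 0
  have hg : Computable g :=
    Computable.option_getD (Computable.option_map he
      (PushdownTable.computable_wordBound.comp Computable.snd).to₂) (Computable.const 0)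
  -- The sum is a crude substitute for a maximum.
  refine ⟨fun s => ∑ i ∈ Finset.range (N s), g i, hg.sum_range.comp hN, ?_⟩
  intro s w D hD hw hs
  obtain ⟨i, hi⟩ := (hmem D).1 hD
  obtain ⟨D', hD', hs'⟩ := hNspec s
  have hiN : i < N s := by
    by_contra! hle
    have := hmono _ _ _ _ hle hD' hi
    omega
  obtain ⟨w', hw', hlen⟩ := hD.exists_short_word ⟨w, by rw [hw]; rfl⟩
  rw [hw] at hw'
  obtain rfl : w' = w := hw'
  refine hlen.trans ?_
  have : D.wordBound = g i := by
    simp only [g]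
    rw [hi]
    rfl
  rw [this]
  exact Finset.single_le_sum (f := g) (fun _ _ => Nat.zero_le _) (Finset.mem_range.2 hiN)

-- Apply the hypothesis to the function that maps a program to the least step bound with which it
-- halts on input `0`. Running each program with the bound `B` would then decide the halting
-- problem.
open Nat.Partrec (Code) in
theorem not_exists_computable_bound_partrec : ¬ ∀ p : ℕ →. ℕ, Partrec p →
    ∃ B : ℕ → ℕ, Computable B ∧ ∀ m, ∀ v ∈ p m, v ≤ B m := by
  intro H
  let run : ℕ → ℕ → Bool := fun m t => (Code.evaln t (Denumerable.ofNat Code m) 0).isSome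
  have hrun : Computable₂ run :=
    Primrec.option_isSome.to_comp.comp <| Code.primrec_evaln.to_comp.comp <|
      (Computable.snd.pair ((Computable.ofNat Code).comp Computable.fst)).pair (Computable.const 0)
  obtain ⟨B, hB, hle⟩ := H _ (Partrec.rfind hrun.partrec₂)
  refine ComputablePred.halting_problem 0 (ComputablePred.computable_iff.2
    ⟨fun c => run (Encodable.encode c) (B (Encodable.encode c)),
      hrun.comp Computable.encode (hB.comp Computable.encode), ?_⟩)
  funext c
  have hc : Denumerable.ofNat Code (Encodable.encode c) = c := Denumerable.ofNat_encode c
  refine propext ⟨fun h => ?_, fun h => ?_⟩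
  · obtain ⟨x, hx⟩ := Part.dom_iff_mem.1 h
    obtain ⟨t, ht⟩ := Code.evaln_complete.1 hx
    have hdom : (Nat.rfind fun t => Part.some (run (Encodable.encode c) t)).Dom :=
      Nat.rfind_dom.2 ⟨t, by simp [run, hc, Option.mem_def.1 ht], fun _ => trivial⟩
    obtain ⟨t₀, ht₀⟩ := Part.dom_iff_mem.1 hdom
    have hspec : true ∈ Part.some (run (Encodable.encode c) t₀) := Nat.rfind_spec ht₀
    replace hspec : run (Encodable.encode c) t₀ = true := (Part.mem_some_iff.1 hspec).symm
    simp only [run, hc] at hspec ⊢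
    obtain ⟨y, hy⟩ := Option.isSome_iff_exists.1 hspec
    exact Option.isSome_iff_exists.2 ⟨y, Code.evaln_mono (hle _ _ ht₀) hy⟩
  · simp only [run, hc] at h
    obtain ⟨y, hy⟩ := Option.isSome_iff_exists.1 h
    exact Part.dom_iff_mem.2 ⟨y, Code.evaln_sound hy⟩

theorem mainTheorem1 (k : ℕ) (hk : 2 ≤ k) :
    DescriptorKind.NonRecursiveTradeOff (oneWayDFA k) pushdownAutomata := by
  rintro c₁ c₂ hc₁ hc₂ ⟨f, hf, -, hbound⟩
  refine not_exists_computable_bound_partrec fun p hp => ?_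
  obtain ⟨M, hM, hdfa, hlang⟩ := HeadTable.exists_computable_of_partrec hp hk
  obtain ⟨B, hB, hword⟩ := exists_computable_wordBound hc₂ 5
  have hsize : Computable fun m => c₁ 5 (M m) := (hc₁.computable 5).comp hM
  -- The minimal size for the language of `M m` need not be computable from `m`, but it is at most
  -- the size of `M m`. As `f` and `B` need not be monotone, the sum runs over all possible values.
  refine ⟨fun m => ∑ s ∈ Finset.range (c₁ 5 (M m) + 1), B (f s),
    (hB.comp hf).sum_range.comp (Computable.succ.comp hsize), fun m v hv => ?_⟩
  obtain ⟨w, hw, hvw⟩ := hlang m v hv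
  have hmem₁ : M m ∈ (oneWayDFA k).of (M m).language := ⟨hdfa m, rfl⟩
  have hmem₂ : PushdownTable.singleton w ∈ pushdownAutomata.of (M m).language :=
    ⟨PushdownTable.isPDA_singleton w, (PushdownTable.language_singleton w).trans hw.symm⟩
  have hle := hbound 5 _ ⟨_, hmem₁⟩ ⟨_, hmem₂⟩
  have hle₁ : (oneWayDFA k).minSize c₁ (M m).language ≤ c₁ 5 (M m) := Nat.sInf_le ⟨_, hmem₁, rfl⟩
  obtain ⟨D, ⟨hD, hDL⟩, hDc⟩ : pushdownAutomata.minSize c₂ (M m).language ∈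
      c₂ 5 '' pushdownAutomata.of (M m).language := Nat.sInf_mem ⟨_, _, hmem₂, rfl⟩
  calc v ≤ w.length := hvw
    _ ≤ B (f ((oneWayDFA k).minSize c₁ (M m).language)) :=
      hword _ w D hD (hDL.trans hw) (hDc.trans_le hle)
    _ ≤ _ := Finset.single_le_sum (f := fun s => B (f s)) (fun _ _ => Nat.zero_le _)
      (Finset.mem_range.2 (Nat.lt_succ_of_le hle₁))
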